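/- For every real $\alpha>0$ and every integer $k\ge 1$ there exist constants $C,c>0$ such that the following holds for all sufficiently large integers $n$. Let $G_\alpha$ be a graph on $n$ vertices with minimum degree $\delta(G_\alpha)\ge \alpha n$, let $b$ be an integer with $1\le b\le \frac{cn}{\ln n}$, and let $p\in[0,1]$ satisfy $p\ge \frac{Cb}{n^2}$. Let $G_{n,p}$ be the binomial random graph on the vertex set of $G_\alpha$, in which each pair of vertices is an edge with probability $p$, independently of all other pairs. Then with probability at least $1-\exp(-cpn^2)$ the following holds: in the $(1:b)$ Maker-Breaker game on the edges of $G_\alpha\cup G_{n,p}$, no matter which player starts, Maker has a strategy to claim all edges of a spanning $k$-vertex-connected subgraph of $G_\alpha\cup G_{n,p}$. Here, in the $(1:b)$ game, Maker and Breaker move alternately; in each move Maker claims one unclaimed edge, and Breaker claims $b$ unclaimed edges (or all of the unclaimed edges if fewer than $b$ remain). The game is played until all edges are claimed. A graph is $k$-vertex-connected if it has more than $k$ vertices and stays connected after the deletion of any fewer than $k$ vertices. -/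

import Mathlib

/-! ### Biased Maker-Breaker games on a hypergraph `(X, F)` -/

namespace MakerBreaker

/-- The two players. -/
inductive Player
  | maker
  | breaker

/-- A strategy for Maker: given the set `M` of elements claimed by Maker so far and the set `B` of
elements claimed by Breaker so far, it names the element that Maker claims next. -/
abbrev Strategy (E : Type*) := Finset E → Finset E → E

variable {E : Type*} [DecidableEq E]

/-- The elements of the board `X` that are still unclaimed. -/
def free (X M B : Finset E) : Finset E := X \ (M ∪ B)

/-- `Reachable b X σ first turn M B`: in the `(1 : b)` game on the board `X`, started by the player
`first`, with Maker playing according to `σ` and Breaker playing arbitrarily, the position in which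
Maker has claimed `M`, Breaker has claimed `B`, and it is the turn of the player `turn`, can occur.
Maker claims one free element in each of her moves. Breaker claims `b` free elements in each of his
moves, or all the free elements if fewer than `b` are left. -/
inductive Reachable (b : ℕ) (X : Finset E) (σ : Strategy E) (first : Player) :
    Player → Finset E → Finset E → Prop
  | start : Reachable b X σ first first ∅ ∅
  | maker_move {M B : Finset E} (h : Reachable b X σ first Player.maker M B)
      (hfree : σ M B ∈ free X M B) :
      Reachable b X σ first Player.breaker (insert (σ M B) M) B
  | breaker_move {M B S : Finset E} (h : Reachable b X σ first Player.breaker M B)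
      (hfree : S ⊆ free X M B) (hcard : S.card = min b (free X M B).card) :
      Reachable b X σ first Player.maker M (B ∪ S)

/-- `σ` is a winning strategy for Maker in the `(1 : b)` game on `(X, F)` started by `first`:
it always provides a legal move as long as there is a free element, and whenever the board has been
completely claimed, Maker owns all the elements of some winning set. -/
def IsWinningStrategy (b : ℕ) (X : Finset E) (F : Set (Finset E)) (first : Player)
    (σ : Strategy E) : Prop :=
  (∀ M B : Finset E, Reachable b X σ first Player.maker M B → (free X M B).Nonempty →
      σ M B ∈ free X M B) ∧
  (∀ (turn : Player) (M B : Finset E), Reachable b X σ first turn M B → free X M B = ∅ →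
      ∃ A ∈ F, A ⊆ M)

/-- Maker has a winning strategy in the `(1 : b)` Maker-Breaker game on `(X, F)` in which the player
`first` makes the first move. -/
def MakerWins (b : ℕ) (X : Finset E) (F : Set (Finset E)) (first : Player) : Prop :=
  ∃ σ : Strategy E, IsWinningStrategy b X F first σ

end MakerBreaker

/-! ### The `k`-vertex-connectivity game -/

namespace SimpleGraph

/-- A graph is `k`-vertex-connected if it has more than `k` vertices and it remains connected
whenever fewer than `k` vertices are deleted. -/
def IsVertexConnected {V : Type*} [Fintype V] (k : ℕ) (G : SimpleGraph V) : Prop :=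
  k < Fintype.card V ∧ ∀ S : Finset V, S.card < k → (G.induce ((S : Set V)ᶜ)).Connected

/-- The board of a game played on the edges of `G`: the finite set of all edges of `G`. -/
noncomputable def edgeBoard {V : Type*} [Finite V] (G : SimpleGraph V) : Finset (Sym2 V) :=
  G.edgeSet.toFinite.toFinset

/-- The winning sets of the `k`-vertex-connectivity game on `G`: the edge sets of the spanning
`k`-vertex-connected subgraphs of `G`. -/
def vertexConnectivityFamily {V : Type*} [Fintype V] (k : ℕ) (G : SimpleGraph V) :
    Set (Finset (Sym2 V)) :=
  {A | (A : Set (Sym2 V)) ⊆ G.edgeSet ∧ (fromEdgeSet (A : Set (Sym2 V))).IsVertexConnected k}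

/-- Maker has a winning strategy in the `(1 : b)` Maker-Breaker game on the edges of `G` in which she
aims to claim a spanning `k`-vertex-connected subgraph of `G`, whichever player moves first. -/
def MakerWinsVertexConnectivity {V : Type*} [Fintype V] [DecidableEq V] (b k : ℕ)
    (G : SimpleGraph V) : Prop :=
  ∀ first : MakerBreaker.Player,
    MakerBreaker.MakerWins b G.edgeBoard (G.vertexConnectivityFamily k) first

end SimpleGraph

/-!
Maker plays as the transversal player: a family of target sets of edges is chosen such that every set
of edges that meets all the targets spans a `k`-vertex-connected graph, and she wins by the biased
Erdős–Selfridge criterion `MakerBreaker.makerWins_of_sum_lt` as soon as the sum of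
`2 ^ (-|T| / b)` over all targets `T` is smaller than `1 / 2`.

The obvious targets are the sets of all edges between `X` and `Y`, for the partitions of the vertices
outside a set `S` with `|S| < k` into nonempty parts `X` and `Y`. The deterministic graph alone makes
most of them large enough. There are at most `3 n ^ k 2 ^ n` pairs `(S, X)`, so a partition crossed by
`Ω(n ^ 2)` edges does no harm if `b ≤ c n / log n`. The sparse cuts of a graph of minimum degree
`α n` cluster around boundedly many sets (`SimpleGraph.exists_net_of_sparse_cuts`: large cells of the
Venn diagram of sparse cuts have at least `α n / 2` elements). In each cluster a central set `C` that
cuts the fewest edges is selected. A partition in the cluster that differs from `C` by a set `D` of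
`d ≥ 1` vertices outside of `S` cannot cut fewer edges than `C`, hence is crossed by at least about
half of the edges that leave `D`, that is by `Ω(d n)` edges
(`SimpleGraph.card_mul_le_two_mul_card_interedges`), whereas there are at most `n ^ d` choices of `D`.

What is left are the partitions induced by the boundedly many central sets themselves, on which the
deterministic graph may have no crossing edges at all. For each central set `C` with linearly many
vertices on either side, `k` disjoint linear-sized sets `P C j` are fixed inside and `k` disjoint
sets `Q C j` outside of it, and the edges between `P C j` and `Q C j` are used as targets. If Maker
hits all of these, she owns `k` disjoint edges across the cut, one of which avoids `S`. Such a target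
need only have `K b` elements for a constant `K`, and a Chernoff bound for the random graph
(`SimpleGraph.binomialRandom_real_card_inter_lt_le`) shows that this fails with probability at most
`exp (-c p n ^ 2)` provided that `p n ^ 2 ≥ C b`.
-/

/-! ### A potential criterion for Maker -/

namespace MakerBreaker

open Finset

variable {E ι : Type*} [DecidableEq E]

/-- The danger of the target set `T i` in the position `(M, B)`, in the game with bias `b`: zero as
soon as Maker owns an element of `T i`, and otherwise `2 ^ (-f / b)`, where `f` is the number of
elements of `T i` that Breaker does not own. -/
noncomputable def danger (b : ℕ) (T : ι → Finset E) (M B : Finset E) (i : ι) : ℝ :=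
  if Disjoint (T i) M then (2 : ℝ) ^ (-((T i \ B).card : ℝ) / b) else 0

/-- The sum of the dangers of all target sets that contain the element `x`. -/
noncomputable def dangerAt (b : ℕ) (s : Finset ι) (T : ι → Finset E) (M B : Finset E) (x : E) : ℝ :=
  ∑ i ∈ s with x ∈ T i, danger b T M B i

lemma danger_nonneg (b : ℕ) (T : ι → Finset E) (M B : Finset E) (i : ι) :
    0 ≤ danger b T M B i := by
  unfold danger
  split_ifs <;> positivity

/-- If Breaker claims at most `b` further elements, the danger of `T i` grows at most linearly in the
number of elements of `T i` among them. This is Bernoulli's inequality `2 ^ (m / b) ≤ 1 + m / b`. -/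
lemma danger_union_le {b : ℕ} (hb : 1 ≤ b) (T : ι → Finset E) (M B S : Finset E) (hS : S.card ≤ b)
    (i : ι) :
    danger b T M (B ∪ S) i ≤ danger b T M B i * (1 + ((S.filter (· ∈ T i)).card : ℝ) / b) := by
  unfold danger
  split_ifs with h
  swap
  · simp
  have hb' : (0 : ℝ) < b := by exact_mod_cast hb
  set m := (S.filter (· ∈ T i)).card with hm
  have hmb : (m : ℝ) / b ≤ 1 := by
    rw [div_le_one hb']
    exact_mod_cast (card_filter_le _ _).trans hS
  have h1 : ((T i \ B).card : ℝ) ≤ (T i \ (B ∪ S)).card + m := by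
    have : T i \ B ⊆ (T i \ (B ∪ S)) ∪ S.filter (· ∈ T i) := by
      intro x
      simp only [mem_sdiff, mem_union, mem_filter]
      tauto
    exact_mod_cast (card_le_card this).trans (card_union_le _ _)
  calc (2 : ℝ) ^ (-((T i \ (B ∪ S)).card : ℝ) / b)
      ≤ (2 : ℝ) ^ (-((T i \ B).card : ℝ) / b + (m : ℝ) / b) := by
        apply Real.rpow_le_rpow_of_exponent_le (by norm_num)
        rw [← add_div]
        gcongr
        linarith
    _ = (2 : ℝ) ^ (-((T i \ B).card : ℝ) / b) * (1 + 1) ^ ((m : ℝ) / b) := by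
        rw [Real.rpow_add (by norm_num)]
        norm_num
    _ ≤ _ := by
        gcongr
        simpa using rpow_one_add_le_one_add_mul_self (s := 1) (by norm_num)
          (by positivity : (0 : ℝ) ≤ (m : ℝ) / b) hmb

lemma sum_danger_union_le {b : ℕ} (hb : 1 ≤ b) (s : Finset ι) (T : ι → Finset E)
    (M B S : Finset E) (hS : S.card ≤ b) :
    ∑ i ∈ s, danger b T M (B ∪ S) i ≤
      ∑ i ∈ s, danger b T M B i + (∑ y ∈ S, dangerAt b s T M B y) / b := by
  refine (sum_le_sum fun i _ => danger_union_le hb T M B S hS i).trans (le_of_eq ?_)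
  simp_rw [mul_add, mul_one, sum_add_distrib, dangerAt, sum_filter]
  rw [sum_comm, sum_div]
  congr 1
  refine sum_congr rfl fun i _ => ?_
  rw [← sum_filter, sum_const, nsmul_eq_mul]
  ring

lemma dangerAt_insert_le (b : ℕ) (s : Finset ι) (T : ι → Finset E) (M B : Finset E) (x y : E) :
    dangerAt b s T (insert x M) B y ≤ dangerAt b s T M B y := by
  refine sum_le_sum fun i _ => ?_
  unfold danger
  split_ifs with h1 h2 h2
  · exact le_rfl
  · exact absurd (h1.mono_right (subset_insert x M)) h2
  · positivity
  · exact le_rfl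

lemma sum_danger_insert (b : ℕ) (s : Finset ι) (T : ι → Finset E) (M B : Finset E) (x : E) :
    ∑ i ∈ s, danger b T (insert x M) B i = ∑ i ∈ s, danger b T M B i - dangerAt b s T M B x := by
  rw [eq_sub_iff_add_eq, dangerAt, sum_filter, ← sum_add_distrib]
  refine sum_congr rfl fun i _ => ?_
  unfold danger
  by_cases hx : x ∈ T i <;> simp [hx]

/-- The strategy of claiming a free element at which the danger is largest. -/
lemma exists_strategy_maximizing_dangerAt [Nonempty E] (b : ℕ) (X : Finset E) (s : Finset ι)
    (T : ι → Finset E) :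
    ∃ σ : Strategy E, ∀ M B, (free X M B).Nonempty → σ M B ∈ free X M B ∧
      ∀ y ∈ free X M B, dangerAt b s T M B y ≤ dangerAt b s T M B (σ M B) := by
  have : ∀ M B : Finset E, ∃ x : E, (free X M B).Nonempty → x ∈ free X M B ∧
      ∀ y ∈ free X M B, dangerAt b s T M B y ≤ dangerAt b s T M B x := by
    intro M B
    by_cases h : (free X M B).Nonempty
    · obtain ⟨x, hx, hmax⟩ := exists_max_image (free X M B) (dangerAt b s T M B) h
      exact ⟨x, fun _ => ⟨hx, hmax⟩⟩
    · exact ⟨Classical.arbitrary E, fun h' => absurd h' h⟩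
  choose σ hσ using this
  exact ⟨σ, hσ⟩

/-- **The biased Erdős–Selfridge criterion**, for the player of bias `1` against the player of
bias `b`: if `∑ i, 2 ^ (-|T i| / b) < 1 / 2`, then Maker can claim an element of every `T i`.
The total danger stays below `1` in all positions, so in the final position no target can lie
entirely within Breaker's set. -/
theorem makerWins_of_sum_lt [Nonempty E] {b : ℕ} (hb : 1 ≤ b) (X : Finset E) (F : Set (Finset E))
    (first : Player) (s : Finset ι) (T : ι → Finset E) (hT : ∀ i ∈ s, T i ⊆ X)
    (hsum : ∑ i ∈ s, (2 : ℝ) ^ (-((T i).card : ℝ) / b) < 1 / 2)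
    (hF : ∀ M ⊆ X, (∀ i ∈ s, ∃ x ∈ T i, x ∈ M) → ∃ A ∈ F, A ⊆ M) :
    MakerWins b X F first := by
  obtain ⟨σ, hσ⟩ := exists_strategy_maximizing_dangerAt b X s T
  have hb' : (0 : ℝ) < b := by exact_mod_cast hb
  -- When Breaker is to move, the total danger stays below `1` whatever he is about to claim.
  have key : ∀ turn M B, Reachable b X σ first turn M B → M ⊆ X ∧
      ((turn = Player.maker ∧ ∑ i ∈ s, danger b T M B i < 1) ∨
        ∀ S ⊆ free X M B, S.card ≤ b → ∑ i ∈ s, danger b T M (B ∪ S) i < 1) := by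
    intro turn M B h
    have h0 : ∑ i ∈ s, danger b T ∅ ∅ i < 1 / 2 := by simpa [danger] using hsum
    induction h with
    | start =>
      refine ⟨empty_subset _, ?_⟩
      right
      intro S _ hS
      have h1 : ∑ i ∈ s, danger b T ∅ (∅ ∪ S) i ≤ ∑ i ∈ s, danger b T ∅ ∅ i * (1 + 1) := by
        refine sum_le_sum fun i _ => (danger_union_le hb T ∅ ∅ S hS i).trans ?_
        have := danger_nonneg b T ∅ ∅ i
        gcongr
        rw [div_le_one hb']
        exact_mod_cast (card_filter_le _ _).trans hS
      rw [← sum_mul] at h1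
      linarith
    | @maker_move M B h hfree ih =>
      obtain ⟨hM, ih⟩ := ih
      have hx := hσ M B ⟨_, hfree⟩
      refine ⟨insert_subset (mem_sdiff.1 hfree).1 hM, ?_⟩
      right
      intro S hS hSb
      have hΦ : ∑ i ∈ s, danger b T M B i < 1 := by
        rcases ih with ⟨-, ih⟩ | ih
        · exact ih
        · simpa using ih ∅ (empty_subset _) (by simp)
      have h1 := sum_danger_union_le hb s T (insert (σ M B) M) B S hSb
      rw [sum_danger_insert b s T M B] at h1
      have h2 : ∑ y ∈ S, dangerAt b s T (insert (σ M B) M) B y ≤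
          ∑ y ∈ S, dangerAt b s T M B (σ M B) := by
        refine sum_le_sum fun y hy => (dangerAt_insert_le _ _ _ _ _ _ _).trans (hx.2 y ?_)
        have := hS hy
        simp only [free, mem_sdiff, mem_union, mem_insert] at this ⊢
        tauto
      rw [sum_const, nsmul_eq_mul] at h2
      have hpos : 0 ≤ dangerAt b s T M B (σ M B) :=
        sum_nonneg fun i _ => danger_nonneg b T M B i
      have h3 : (∑ y ∈ S, dangerAt b s T (insert (σ M B) M) B y) / b ≤
          dangerAt b s T M B (σ M B) := by
        rw [div_le_iff₀ hb', mul_comm]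
        refine h2.trans ?_
        gcongr
      linarith
    | @breaker_move M B S h hfree hcard ih =>
      obtain ⟨hM, ih⟩ := ih
      refine ⟨hM, ?_⟩
      rcases ih with ⟨h', -⟩ | ih
      · cases h'
      · exact Or.inl ⟨rfl, ih S hfree (hcard ▸ min_le_left _ _)⟩
  refine ⟨σ, fun M B _ hne => (hσ M B hne).1, fun turn M B h hfull => ?_⟩
  obtain ⟨hM, hΦ⟩ := key turn M B h
  have hΦ : ∑ i ∈ s, danger b T M B i < 1 := by
    rcases hΦ with ⟨-, hΦ⟩ | hΦ
    · exact hΦ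
    · simpa using hΦ ∅ (empty_subset _) (by simp)
  refine hF M hM fun i hi => ?_
  by_contra hcon
  push Not at hcon
  have hdisj : Disjoint (T i) M := disjoint_left.2 hcon
  have hsub : T i \ B = ∅ := by
    rw [sdiff_eq_empty_iff_subset]
    intro x hx
    by_contra hxB
    have : x ∈ free X M B := mem_sdiff.2 ⟨hT i hi hx, by simp [hcon x hx, hxB]⟩
    simp [hfull] at this
  have h1 : danger b T M B i = 1 := by simp [danger, hdisj, hsub]
  have := single_le_sum (f := danger b T M B) (fun i _ => danger_nonneg b T M B i) hi
  linarith

end MakerBreaker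

/-! ### Sparse cuts of a graph of large minimum degree -/

namespace SimpleGraph

open Finset

lemma pairwiseDisjoint_image_mk {V : Type*} [DecidableEq V] (s : Set V) (f : V → Finset V) :
    s.PairwiseDisjoint fun u => (f u).image (Prod.mk u) := by
  intro u _ u' _ hne
  rw [Function.onFun, Finset.disjoint_left]
  simp only [mem_image, not_exists, not_and]
  rintro _ ⟨w, -, rfl⟩ w' - h
  exact hne (Prod.mk.inj h).1.symm

lemma card_biUnion_image_mk {V : Type*} [DecidableEq V] (s : Finset V) (f : V → Finset V) :
    (s.biUnion fun u => (f u).image (Prod.mk u)).card = ∑ u ∈ s, (f u).card := by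
  rw [card_biUnion (pairwiseDisjoint_image_mk _ f)]
  exact sum_congr rfl fun u _ => card_image_of_injective _ (Prod.mk_right_injective u)

variable {V : Type*} [DecidableEq V] {G : SimpleGraph V} [DecidableRel G.Adj]

/-- A set of ordered pairs of adjacent vertices, each joining `X` to `Y` or `D` to `S`, has at most
`2 e(X, Y) + 2 |D| |S|` elements. -/
lemma card_le_of_forall_mem_or {P : Finset (V × V)} {X Y D S : Finset V}
    (h : ∀ u w, (u, w) ∈ P → G.Adj u w ∧ ((u ∈ X ∧ w ∈ Y) ∨ (u ∈ Y ∧ w ∈ X) ∨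
      (u ∈ D ∧ w ∈ S) ∨ (u ∈ S ∧ w ∈ D))) :
    P.card ≤ 2 * (G.interedges X Y).card + 2 * (D.card * S.card) := by
  have hsub : P ⊆ (G.interedges X Y ∪ G.interedges Y X) ∪ (D ×ˢ S ∪ S ×ˢ D) := by
    rintro ⟨u, w⟩ hz
    have := h u w hz
    simp only [mem_union, mem_interedges_iff, mem_product]
    tauto
  have h3 : (G.interedges Y X).card = (G.interedges X Y).card :=
    have : Std.Symm G.Adj := ⟨fun _ _ h => h.symm⟩
    Rel.card_interedges_comm _ _
  have h1 := card_le_card hsub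
  have h2 := card_union_le (G.interedges X Y ∪ G.interedges Y X) (D ×ˢ S ∪ S ×ˢ D)
  have h4 := card_union_le (G.interedges X Y) (G.interedges Y X)
  have h5 := card_union_le (D ×ˢ S) (S ×ˢ D)
  rw [card_product, card_product, mul_comm S.card] at h5
  omega

variable [Fintype V]

variable (G) in
/-- The ordered pairs `(u, w)` of adjacent vertices that are separated by `A`. Every edge of the cut
`(A, Aᶜ)` occurs in both orders. -/
def cutPairs (A : Finset V) : Finset (V × V) :=
  univ.filter fun z => G.Adj z.1 z.2 ∧ ¬ (z.1 ∈ A ↔ z.2 ∈ A)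

variable (G) in
lemma cutPairs_empty : G.cutPairs ∅ = ∅ := by simp [cutPairs]

variable (G) in
lemma cutPairs_univ : G.cutPairs univ = ∅ := by simp [cutPairs]

lemma card_mul_le_card_interedges_compl {d : ℝ} (hd : ∀ v, d ≤ G.degree v) (D : Finset V) :
    (D.card : ℝ) * (d - D.card) ≤ (G.interedges D Dᶜ).card := by
  have h : G.interedges D Dᶜ = D.biUnion fun u => (G.neighborFinset u \ D).image (Prod.mk u) := by
    ext ⟨u, w⟩
    simp only [mem_interedges_iff, mem_compl, mem_biUnion, mem_image, mem_sdiff,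
      mem_neighborFinset, Prod.mk.injEq]
    constructor
    · rintro ⟨h1, h2, h3⟩
      exact ⟨u, h1, w, ⟨h3, h2⟩, rfl, rfl⟩
    · rintro ⟨u', h1, w', ⟨h2, h3⟩, rfl, rfl⟩
      exact ⟨h1, h3, h2⟩
  rw [h, card_biUnion_image_mk]
  push_cast
  rw [← nsmul_eq_mul, ← sum_const]
  refine sum_le_sum fun u _ => ?_
  have := le_card_sdiff D (G.neighborFinset u)
  rw [card_neighborFinset_eq_degree] at this
  have h2 : (G.degree u : ℝ) ≤ (G.neighborFinset u \ D).card + D.card := by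
    exact_mod_cast (by omega : G.degree u ≤ (G.neighborFinset u \ D).card + D.card)
  linarith [hd u]

lemma two_mul_card_interedges_compl_le (D : Finset V) :
    2 * (G.interedges D Dᶜ).card ≤ (G.cutPairs D).card := by
  have h : Disjoint (G.interedges D Dᶜ) (G.interedges Dᶜ D) := by
    rw [Finset.disjoint_left]
    rintro ⟨u, w⟩ h1 h2
    simp only [mem_interedges_iff, mem_compl] at h1 h2
    tauto
  have h2 : G.interedges D Dᶜ ∪ G.interedges Dᶜ D ⊆ G.cutPairs D := by
    rintro ⟨u, w⟩
    simp only [mem_interedges_iff, mem_compl, mem_union, cutPairs, mem_filter, mem_univ, true_and]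
    tauto
  have h3 : (G.interedges Dᶜ D).card = (G.interedges D Dᶜ).card :=
    have : Std.Symm G.Adj := ⟨fun _ _ h => h.symm⟩
    Rel.card_interedges_comm _ _
  have := card_le_card h2
  rw [card_union_of_disjoint h, h3] at this
  omega

/-- If `C` does not cut more edges than the modified set `symmDiff C D`, then the latter cuts at
least half of the edges that leave `D`; this remains true up to `|D| |S|` edges when a set `S`
disjoint from `D` is deleted. -/
lemma card_mul_le_two_mul_card_interedges {d : ℝ} (hd : ∀ v, d ≤ G.degree v) {C D S : Finset V}
    (hDS : Disjoint D S) (hC : (G.cutPairs C).card ≤ (G.cutPairs (symmDiff C D)).card) :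
    (D.card : ℝ) * (d - D.card - 2 * S.card) ≤
      2 * (G.interedges (symmDiff C D \ S) ((symmDiff C D)ᶜ \ S)).card := by
  set A := symmDiff C D with hA
  have hmem : ∀ v, v ∈ A ↔ (v ∈ C ∧ v ∉ D) ∨ (v ∈ D ∧ v ∉ C) := fun v => by
    rw [hA, mem_symmDiff]
  -- The pairs separated by `A` and by `C` agree except among the pairs separated by `D`.
  have e1 := card_filter_add_card_filter_not (s := G.cutPairs A) (fun z => z.1 ∈ D ↔ z.2 ∈ D)
  have e2 := card_filter_add_card_filter_not (s := G.cutPairs C) (fun z => z.1 ∈ D ↔ z.2 ∈ D)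
  have e3 := card_filter_add_card_filter_not (s := G.cutPairs D) (fun z => z.1 ∈ A ↔ z.2 ∈ A)
  have e4 : (G.cutPairs A).filter (fun z => z.1 ∈ D ↔ z.2 ∈ D) =
      (G.cutPairs C).filter (fun z => z.1 ∈ D ↔ z.2 ∈ D) := by
    ext ⟨u, w⟩
    simp only [cutPairs, mem_filter, mem_univ, true_and, hmem]
    tauto
  have e5 : (G.cutPairs D).filter (fun z => z.1 ∈ A ↔ z.2 ∈ A) =
      (G.cutPairs C).filter (fun z => ¬ (z.1 ∈ D ↔ z.2 ∈ D)) := by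
    ext ⟨u, w⟩
    simp only [cutPairs, mem_filter, mem_univ, true_and, hmem]
    tauto
  have e6 : (G.cutPairs D).filter (fun z => ¬ (z.1 ∈ A ↔ z.2 ∈ A)) =
      (G.cutPairs A).filter (fun z => ¬ (z.1 ∈ D ↔ z.2 ∈ D)) := by
    ext ⟨u, w⟩
    simp only [cutPairs, mem_filter, mem_univ, true_and]
    tauto
  have e7 : ((G.cutPairs A).filter (fun z => ¬ (z.1 ∈ D ↔ z.2 ∈ D))).card ≤
      2 * (G.interedges (A \ S) (Aᶜ \ S)).card + 2 * (D.card * S.card) := by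
    refine card_le_of_forall_mem_or fun u w hz => ?_
    have hu : u ∈ D → u ∉ S := fun h => Finset.disjoint_left.1 hDS h
    have hw : w ∈ D → w ∉ S := fun h => Finset.disjoint_left.1 hDS h
    simp only [cutPairs, mem_filter, mem_univ, true_and] at hz
    simp only [mem_sdiff, mem_compl]
    refine ⟨hz.1.1, ?_⟩
    have hz1 := hz.1.2
    have hz2 := hz.2
    clear e1 e2 e3 e4 e5 e6 hmem hC hz
    by_cases hu1 : u ∈ D <;> by_cases hw1 : w ∈ D <;> by_cases hu2 : u ∈ A <;>
      by_cases hw2 : w ∈ A <;> simp only [hu1, hw1, hu2, hw2, iff_true, iff_false, not_true,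
        not_false_iff, true_implies, false_and, and_false, true_and, and_true, false_or,
        or_false] at * <;> tauto
  have e8 : (G.cutPairs D).card ≤
      2 * (2 * (G.interedges (A \ S) (Aᶜ \ S)).card + 2 * (D.card * S.card)) := by
    rw [e4] at e1
    rw [e5, e6] at e3
    omega
  have e9 := two_mul_card_interedges_compl_le (G := G) D
  have e10 := card_mul_le_card_interedges_compl hd D
  have e11 : ((G.interedges D Dᶜ).card : ℝ) ≤
      2 * (G.interedges (A \ S) (Aᶜ \ S)).card + 2 * (D.card * S.card) := by
    exact_mod_cast (by omega : (G.interedges D Dᶜ).card ≤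
      2 * (G.interedges (A \ S) (Aᶜ \ S)).card + 2 * (D.card * S.card))
  linarith

/-- Among many sparse cuts of a graph with minimum degree at least `α n`, two are close to each
other. All but few vertices lie in large cells of the Venn diagram of the cuts, since a vertex in a
small cell has many neighbours outside of its cell; and a large cell has at least `α n / 2`
elements, so that there are boundedly many. By pigeonhole two of the cuts contain the same large
cells. -/
lemma exists_card_symmDiff_le {α η δ : ℝ} (hα : 0 < α) {r : ℕ} (hr : 2 / α ≤ r)
    (hdeg : ∀ v, α * Fintype.card V ≤ G.degree v) {𝒜 : Finset (Finset V)}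
    (h𝒜 : ∀ A ∈ 𝒜, ((G.cutPairs A).card : ℝ) ≤ δ * (Fintype.card V : ℝ) ^ 2)
    (hcard : 2 ^ r < 𝒜.card) (hδ : 2 * (𝒜.card * δ) ≤ α * η) :
    ∃ A ∈ 𝒜, ∃ A' ∈ 𝒜, A ≠ A' ∧ ((symmDiff A A').card : ℝ) ≤ η * Fintype.card V := by
  set n : ℝ := (Fintype.card V : ℝ) with hn
  rcases isEmpty_or_nonempty V with hV | hV
  · have h1 : 1 < 𝒜.card := lt_of_le_of_lt Nat.one_le_two_pow hcard
    obtain ⟨A, hA, A', hA', hne⟩ := one_lt_card.1 h1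
    exact absurd (Subsingleton.elim A A') hne
  have hn0 : 0 < n := by rw [hn]; exact_mod_cast Fintype.card_pos
  -- The cell of `v` is the set of vertices with the same value of `χ`.
  let χ : V → Finset (Finset V) := fun v => 𝒜.filter (v ∈ ·)
  let cell : V → Finset V := fun v => univ.filter (fun w => χ w = χ v)
  let W : Finset V := univ.filter fun v => ((cell v).card : ℝ) < α * n / 2
  have hW : (W.card : ℝ) ≤ η * n := by
    have h1 : W.card * (α * n / 2) ≤ ((univ.filter fun z : V × V => G.Adj z.1 z.2 ∧
        χ z.1 ≠ χ z.2).card : ℝ) := by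
      have : (W.biUnion fun v => (G.neighborFinset v \ cell v).image (Prod.mk v)) ⊆
          univ.filter fun z : V × V => G.Adj z.1 z.2 ∧ χ z.1 ≠ χ z.2 := by
        intro z
        simp only [mem_biUnion, mem_image, mem_sdiff, mem_neighborFinset, mem_filter, mem_univ,
          true_and, cell]
        rintro ⟨v, -, w, ⟨h1, h2⟩, rfl⟩
        exact ⟨h1, fun h => h2 h.symm⟩
      refine le_trans ?_ (Nat.cast_le.2 (card_le_card this))
      rw [card_biUnion_image_mk]
      push_cast
      rw [← nsmul_eq_mul, ← sum_const]
      refine sum_le_sum fun v hv => ?_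
      have h2 := le_card_sdiff (cell v) (G.neighborFinset v)
      rw [card_neighborFinset_eq_degree] at h2
      have h3 : (G.degree v : ℝ) ≤ (G.neighborFinset v \ cell v).card + (cell v).card := by
        exact_mod_cast (by omega :
          G.degree v ≤ (G.neighborFinset v \ cell v).card + (cell v).card)
      have h4 := (mem_filter.1 hv).2
      linarith [hdeg v]
    have h2 : (univ.filter fun z : V × V => G.Adj z.1 z.2 ∧ χ z.1 ≠ χ z.2) ⊆
        𝒜.biUnion fun A => G.cutPairs A := by
      rintro ⟨u, w⟩ hz
      simp only [mem_filter, mem_univ, true_and] at hz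
      by_contra hcon
      simp only [mem_biUnion, cutPairs, mem_filter, mem_univ, true_and, not_exists, not_and,
        not_not] at hcon
      refine hz.2 (filter_congr fun A hA => ?_)
      exact hcon A hA hz.1
    have h3 : (((univ.filter fun z : V × V => G.Adj z.1 z.2 ∧ χ z.1 ≠ χ z.2).card : ℕ) : ℝ) ≤
        𝒜.card * (δ * n ^ 2) := by
      refine (Nat.cast_le.2 ((card_le_card h2).trans card_biUnion_le)).trans ?_
      push_cast
      rw [← nsmul_eq_mul, ← sum_const]
      exact sum_le_sum h𝒜
    have h4 : (α * n / 2) * W.card ≤ (α * n / 2) * (η * n) := by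
      nlinarith [mul_le_mul_of_nonneg_right hδ (sq_nonneg n)]
    exact le_of_mul_le_mul_left h4 (by positivity)
  let 𝓑 : Finset (Finset (Finset V)) := (univ.filter (· ∉ W)).image χ
  have h𝓑 : 𝓑.card ≤ r := by
    have h1 : (𝓑.card : ℝ) * (α * n / 2) ≤ n := by
      have h2 : ∑ c ∈ 𝓑, ((univ.filter fun w => χ w = c).card : ℝ) ≤ n := by
        rw [hn, ← card_univ]
        have := card_eq_sum_card_fiberwise (s := univ.filter (fun w => χ w ∈ 𝓑)) (t := 𝓑) (f := χ)
          (fun w hw => (mem_filter.1 hw).2)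
        have h5 : ∑ c ∈ 𝓑, (univ.filter fun w => χ w = c).card =
            (univ.filter (fun w => χ w ∈ 𝓑)).card := by
          rw [this]
          refine sum_congr rfl fun c hc => ?_
          congr 1
          ext w
          simp only [mem_filter, mem_univ, true_and]
          constructor
          · rintro rfl
            exact ⟨hc, rfl⟩
          · exact fun h => h.2
        exact_mod_cast h5.trans_le (card_le_card (filter_subset _ _))
      refine le_trans ?_ h2
      rw [← nsmul_eq_mul, ← sum_const]
      refine sum_le_sum fun c hc => ?_
      obtain ⟨v, hv, rfl⟩ := mem_image.1 hc
      simp only [W, mem_filter, mem_univ, true_and, not_lt] at hv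
      exact hv
    have h3 : (𝓑.card : ℝ) ≤ 2 / α := by
      rw [le_div_iff₀ hα]
      have h4 : n * (𝓑.card * α) ≤ n * 2 := by linarith
      exact le_of_mul_le_mul_left h4 hn0
    exact_mod_cast h3.trans hr
  obtain ⟨A, hA, A', hA', hne, heq⟩ := exists_ne_map_eq_of_card_lt_of_maps_to (s := 𝒜)
    (t := 𝓑.powerset) (f := fun A => 𝓑.filter (A ∈ ·))
    (by rw [card_powerset]; exact (Nat.pow_le_pow_right (by norm_num) h𝓑).trans_lt hcard)
    (fun A _ => mem_powerset.2 (filter_subset _ _))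
  refine ⟨A, hA, A', hA', hne, le_trans ?_ hW⟩
  refine Nat.cast_le.2 (card_le_card fun v hv => ?_)
  by_contra hvW
  have h1 : χ v ∈ 𝓑 := mem_image_of_mem _ (by simp [hvW])
  have h2 : A ∈ χ v ↔ A' ∈ χ v := by
    have := congrArg (χ v ∈ ·) heq
    simpa [mem_filter, h1] using this
  simp only [χ, mem_filter, hA, hA', true_and] at h2
  rw [mem_symmDiff] at hv
  tauto

/-- The sparse cuts of a graph of large minimum degree have a bounded net in the Hamming metric. -/
lemma exists_net_of_sparse_cuts {α η δ : ℝ} (hα : 0 < α) (hη : 0 ≤ η) {r : ℕ} (hr : 2 / α ≤ r)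
    (hdeg : ∀ v, α * Fintype.card V ≤ G.degree v) (hδ : 2 * ((2 ^ r + 1) * δ) ≤ α * η) :
    ∃ 𝒜 : Finset (Finset V), 𝒜.card ≤ 2 ^ r ∧
      ∀ A : Finset V, ((G.cutPairs A).card : ℝ) ≤ δ * (Fintype.card V : ℝ) ^ 2 →
        ∃ R ∈ 𝒜, ((symmDiff A R).card : ℝ) ≤ η * Fintype.card V := by
  classical
  let 𝓢 : Finset (Finset (Finset V)) := univ.filter fun 𝒜 =>
    (∀ A ∈ 𝒜, ((G.cutPairs A).card : ℝ) ≤ δ * (Fintype.card V : ℝ) ^ 2) ∧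
    ∀ A ∈ 𝒜, ∀ A' ∈ 𝒜, ((symmDiff A A').card : ℝ) ≤ η * Fintype.card V → A = A'
  have hne : 𝓢.Nonempty := ⟨∅, by simp [𝓢]⟩
  obtain ⟨𝒜, h𝒜, hmax⟩ := exists_max_image 𝓢 card hne
  obtain ⟨h1, h2⟩ := (mem_filter.1 h𝒜).2
  refine ⟨𝒜, ?_, fun A hA => ?_⟩
  · by_contra hcon
    obtain ⟨ℬ, hℬ, hcard⟩ := exists_subset_card_eq (s := 𝒜) (n := 2 ^ r + 1) (by omega)
    obtain ⟨A, hA, A', hA', hne, hle⟩ := exists_card_symmDiff_le hα hr hdeg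
      (𝒜 := ℬ) (fun A hA => h1 A (hℬ hA)) (by omega) (by rw [hcard]; push_cast; exact hδ)
    exact hne (h2 A (hℬ hA) A' (hℬ hA') hle)
  · by_contra hcon
    push Not at hcon
    have hA𝒜 : A ∉ 𝒜 := fun h => by
      have := hcon A h
      rw [symmDiff_self] at this
      simp only [bot_eq_empty, card_empty, Nat.cast_zero] at this
      have h0 : 0 ≤ η * Fintype.card V := by positivity
      linarith
    have hins : insert A 𝒜 ∈ 𝓢 := by
      refine mem_filter.2 ⟨mem_univ _, ?_, ?_⟩
      · intro B hB
        rcases mem_insert.1 hB with rfl | hB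
        · exact hA
        · exact h1 B hB
      · intro B hB B' hB' hle
        rcases mem_insert.1 hB with rfl | h3 <;> rcases mem_insert.1 hB' with rfl | h4
        · rfl
        · exact absurd hle (not_le.2 (hcon _ h4))
        · rw [symmDiff_comm] at hle
          exact absurd hle (not_le.2 (hcon _ h3))
        · exact h2 B h3 B' h4 hle
    have := hmax _ hins
    rw [card_insert_of_notMem hA𝒜] at this
    omega

/-- There is a bounded family `𝒞` of vertex sets such that every partition of the vertices outside
a small set `S` into two nonempty parts `X` and `Y` falls into one of three cases: quadratically many
edges run between `X` and `Y`; or `X` differs from a member of `𝒞` by a nonempty set `D` outside of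
`S`, and at least `α n |D| / 8` edges run between `X` and `Y`; or `X` agrees outside of `S` with a
member of `𝒞` that is neither very small nor very large.

Besides `∅` and `univ`, the family contains, for each point of a net of the sparse cuts, a set that
cuts the fewest edges within a ball around this point. -/
lemma exists_central_cuts {α δ : ℝ} (hα : 0 < α) {r k : ℕ} (hr : 2 / α ≤ r)
    (hδ : 12 * ((2 ^ r + 1) * δ) ≤ α ^ 2)
    (hdeg : ∀ v, α * Fintype.card V ≤ G.degree v)
    (hkα : 8 * (k : ℝ) ≤ α * Fintype.card V) (hkδ : 4 * (k : ℝ) ≤ δ * Fintype.card V) :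
    ∃ 𝒞 : Finset (Finset V), 𝒞.card ≤ 2 ^ r + 2 ∧
      ∀ S X : Finset V, S.card < k → Disjoint X S → X.Nonempty → (Xᶜ \ S).Nonempty →
        δ / 4 * (Fintype.card V : ℝ) ^ 2 ≤ (G.interedges X (Xᶜ \ S)).card ∨
        ∃ C ∈ 𝒞, α / 8 * Fintype.card V * ((symmDiff X C \ S).card : ℝ) ≤
            (G.interedges X (Xᶜ \ S)).card ∧
          ((symmDiff X C \ S).Nonempty ∨
            (α / 2 * Fintype.card V ≤ C.card ∧ α / 2 * Fintype.card V ≤ Cᶜ.card)) := by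
  classical
  set n : ℝ := (Fintype.card V : ℝ) with hn
  obtain ⟨𝒜, h𝒜card, h𝒜⟩ := exists_net_of_sparse_cuts (G := G) (η := α / 6) (δ := δ) hα
    (by positivity) hr hdeg (by nlinarith)
  have hmin : ∀ R : Finset V, ∃ C : Finset V, ((symmDiff C R).card : ℝ) ≤ α / 3 * n ∧
      ∀ A : Finset V, ((symmDiff A R).card : ℝ) ≤ α / 3 * n →
        (G.cutPairs C).card ≤ (G.cutPairs A).card := by
    intro R
    obtain ⟨C, hC, hmin⟩ := exists_min_image
      (univ.filter fun A : Finset V => ((symmDiff A R).card : ℝ) ≤ α / 3 * n)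
      (fun A => (G.cutPairs A).card) ⟨R, by simp; positivity⟩
    exact ⟨C, (mem_filter.1 hC).2, fun A hA => hmin A (mem_filter.2 ⟨mem_univ _, hA⟩)⟩
  choose ctr hctr hctr_min using hmin
  -- The lower bound for a cut near a set `C` that is minimal in the required sense.
  have main : ∀ S X C : Finset V, S.card < k → Disjoint X S →
      (G.cutPairs C).card ≤ (G.cutPairs (symmDiff C (symmDiff X C \ S))).card →
      ((symmDiff X C \ S).card : ℝ) ≤ α / 2 * n →
      α / 8 * n * ((symmDiff X C \ S).card : ℝ) ≤ (G.interedges X (Xᶜ \ S)).card := by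
    intro S X C hS hXS hle hD
    have h1 := card_mul_le_two_mul_card_interedges hdeg (C := C) (D := symmDiff X C \ S)
      sdiff_disjoint hle
    have hX : symmDiff C (symmDiff X C \ S) \ S = X := by
      ext v
      have : v ∈ X → v ∉ S := fun h => Finset.disjoint_left.1 hXS h
      simp only [mem_sdiff, mem_symmDiff]
      tauto
    have hY : (symmDiff C (symmDiff X C \ S))ᶜ \ S = Xᶜ \ S := by
      ext v
      simp only [mem_sdiff, mem_symmDiff, mem_compl]
      tauto
    rw [hX, hY] at h1
    have hSk : (S.card : ℝ) ≤ k := by exact_mod_cast hS.le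
    have h2 : α / 4 * n ≤ α * n - ((symmDiff X C \ S).card : ℝ) - 2 * S.card := by linarith
    have h3 := mul_le_mul_of_nonneg_left h2 (Nat.cast_nonneg (α := ℝ) (symmDiff X C \ S).card)
    linarith
  refine ⟨insert ∅ (insert univ (𝒜.image ctr)), ?_, ?_⟩
  · have h1 := card_insert_le (∅ : Finset V) (insert univ (𝒜.image ctr))
    have h2 := card_insert_le (univ : Finset V) (𝒜.image ctr)
    have h3 := card_image_le (s := 𝒜) (f := ctr)
    omega
  intro S X hS hXS hXne hYne
  have hSk : (S.card : ℝ) ≤ k := by exact_mod_cast hS.le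
  by_cases hXbig : (X.card : ℝ) < α / 2 * n
  · right
    have hD : symmDiff X ∅ \ S = X := by
      rw [← bot_eq_empty, symmDiff_bot, sdiff_eq_self_of_disjoint hXS]
    refine ⟨∅, mem_insert_self _ _, main S X ∅ hS hXS ?_ ?_, Or.inl ?_⟩
    · simp [cutPairs_empty]
    · rw [hD]; exact hXbig.le
    · rwa [hD]
  by_cases hYbig : ((Xᶜ \ S).card : ℝ) < α / 2 * n
  · right
    have hD : symmDiff X univ \ S = Xᶜ \ S := by
      rw [← top_eq_univ, symmDiff_top]
      rfl
    refine ⟨univ, by simp, main S X univ hS hXS ?_ ?_, Or.inl ?_⟩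
    · simp [cutPairs_univ]
    · rw [hD]; exact hYbig.le
    · rwa [hD]
  push Not at hXbig hYbig
  by_cases hsparse : ((G.cutPairs X).card : ℝ) ≤ δ * n ^ 2
  swap
  · left
    have h1 : (G.cutPairs X).card ≤ 2 * (G.interedges X (Xᶜ \ S)).card +
        2 * ((univ : Finset V).card * S.card) := by
      refine card_le_of_forall_mem_or fun u w hz => ?_
      have hu : u ∈ X → u ∉ S := fun h => Finset.disjoint_left.1 hXS h
      have hw : w ∈ X → w ∉ S := fun h => Finset.disjoint_left.1 hXS h
      simp only [cutPairs, mem_filter, mem_univ, true_and] at hz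
      simp only [mem_sdiff, mem_compl, mem_univ, true_and]
      tauto
    have h2 : ((G.cutPairs X).card : ℝ) ≤ 2 * (G.interedges X (Xᶜ \ S)).card +
        2 * (n * S.card) := by
      rw [hn, ← card_univ]
      exact_mod_cast h1
    have hn0 : 0 ≤ n := by positivity
    have h3 : n * S.card ≤ n * (δ * n / 4) := by
      gcongr
      linarith
    nlinarith
  right
  obtain ⟨R, hR, hXR⟩ := h𝒜 X hsparse
  have htri : ((symmDiff X (ctr R)).card : ℝ) ≤ α / 2 * n := by
    have h1 : symmDiff X (ctr R) ⊆ symmDiff X R ∪ symmDiff (ctr R) R := by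
      intro v
      simp only [mem_union, mem_symmDiff]
      tauto
    have h2 : ((symmDiff X (ctr R)).card : ℝ) ≤
        (symmDiff X R).card + (symmDiff (ctr R) R).card := by
      exact_mod_cast (card_le_card h1).trans (card_union_le _ _)
    linarith [hctr R]
  refine ⟨ctr R, by simp only [mem_insert, mem_image]; exact Or.inr (Or.inr ⟨R, hR, rfl⟩),
    main S X (ctr R) hS hXS (hctr_min R _ ?_) ?_, ?_⟩
  · have h1 : symmDiff (symmDiff (ctr R) (symmDiff X (ctr R) \ S)) R ⊆ symmDiff X R ∪ S := by
      intro v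
      simp only [mem_union, mem_symmDiff, mem_sdiff]
      tauto
    have h2 : ((symmDiff (symmDiff (ctr R) (symmDiff X (ctr R) \ S)) R).card : ℝ) ≤
        (symmDiff X R).card + S.card := by
      exact_mod_cast (card_le_card h1).trans (card_union_le _ _)
    linarith
  · exact (Nat.cast_le.2 (card_le_card sdiff_subset)).trans htri
  · by_cases hDne : (symmDiff X (ctr R) \ S).Nonempty
    · exact Or.inl hDne
    · right
      rw [not_nonempty_iff_eq_empty] at hDne
      have hv : ∀ v, v ∉ S → (v ∈ X ↔ v ∈ ctr R) := by
        intro v hvS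
        have : v ∉ symmDiff X (ctr R) \ S := by simp [hDne]
        simp only [mem_sdiff, mem_symmDiff] at this
        tauto
      constructor
      · refine hXbig.trans (Nat.cast_le.2 (card_le_card fun v hvX => ?_))
        exact (hv v (Finset.disjoint_left.1 hXS hvX)).1 hvX
      · refine hYbig.trans (Nat.cast_le.2 (card_le_card fun v hvY => ?_))
        rw [mem_sdiff, mem_compl] at hvY
        rw [mem_compl]
        exact fun h => hvY.1 ((hv v hvY.2).2 h)

end SimpleGraph

/-! ### From claimed crossing edges to vertex connectivity -/

namespace SimpleGraph

open Finset

lemma mem_edgeBoard {V : Type*} [Finite V] {G : SimpleGraph V} {e : Sym2 V} :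
    e ∈ G.edgeBoard ↔ e ∈ G.edgeSet := by
  simp [edgeBoard]

lemma injOn_mk_product {V : Type*} {X Y : Finset V} (h : Disjoint X Y) :
    Set.InjOn (fun z : V × V => s(z.1, z.2)) (X ×ˢ Y : Finset (V × V)) := by
  rintro ⟨x, y⟩ h1 ⟨x', y'⟩ h2 heq
  simp only [coe_product, Set.mem_prod, mem_coe] at h1 h2
  rcases Sym2.eq_iff.1 heq with ⟨h3, h4⟩ | ⟨h3, h4⟩
  · exact Prod.ext h3 h4
  · refine absurd h1.1 fun hx => Finset.disjoint_left.1 h hx ?_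
    rw [show x = y' from h3]
    exact h2.2

section CrossEdges

variable {V : Type*} [DecidableEq V]

/-- The unordered pairs with one element in `X` and one in `Y`. -/
def crossEdges (X Y : Finset V) : Finset (Sym2 V) :=
  (X ×ˢ Y).image fun z => s(z.1, z.2)

lemma mem_crossEdges {X Y : Finset V} {e : Sym2 V} :
    e ∈ crossEdges X Y ↔ ∃ x ∈ X, ∃ y ∈ Y, s(x, y) = e := by
  simp only [crossEdges, mem_image, mem_product, Prod.exists]
  constructor
  · rintro ⟨x, y, ⟨hx, hy⟩, rfl⟩
    exact ⟨x, hx, y, hy, rfl⟩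
  · rintro ⟨x, hx, y, hy, rfl⟩
    exact ⟨x, y, ⟨hx, hy⟩, rfl⟩

lemma card_crossEdges {X Y : Finset V} (h : Disjoint X Y) :
    (crossEdges X Y).card = X.card * Y.card := by
  rw [crossEdges, card_image_of_injOn (injOn_mk_product h), card_product]

lemma not_isDiag_of_mem_crossEdges {X Y : Finset V} (h : Disjoint X Y) {e : Sym2 V}
    (he : e ∈ crossEdges X Y) : ¬ e.IsDiag := by
  obtain ⟨x, hx, y, hy, rfl⟩ := mem_crossEdges.1 he
  rw [Sym2.mk_isDiag_iff]
  rintro rfl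
  exact Finset.disjoint_left.1 h hx hy

variable [Fintype V]

lemma card_interedges_le_card_crossEdges {G H : SimpleGraph V} [DecidableRel G.Adj] (hGH : G ≤ H)
    {X Y : Finset V} (h : Disjoint X Y) :
    (G.interedges X Y).card ≤ (crossEdges X Y ∩ H.edgeBoard).card := by
  refine card_le_card_of_injOn (fun z => s(z.1, z.2)) ?_ ((injOn_mk_product h).mono ?_)
  · rintro ⟨x, y⟩ hz
    obtain ⟨hx, hy, hxy⟩ := (mem_interedges_iff G).1 hz
    exact mem_inter.2 ⟨mem_crossEdges.2 ⟨x, hx, y, hy, rfl⟩, mem_edgeBoard.2 (hGH hxy)⟩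
  · rintro ⟨x, y⟩ hz
    obtain ⟨hx, hy, -⟩ := (mem_interedges_iff G).1 hz
    exact mem_product.2 ⟨hx, hy⟩

end CrossEdges

section Connectivity

variable {V : Type*} [DecidableEq V]

/-- Among `k` disjoint edges across a cut, at least one survives the deletion of fewer than `k`
vertices. -/
lemma exists_adj_of_disjoint_pairs {H : SimpleGraph V} {k : ℕ} {P Q : ℕ → Finset V}
    (hdisj : ∀ i < k, ∀ j < k, i ≠ j → Disjoint (P i ∪ Q i) (P j ∪ Q j))
    (hadj : ∀ j < k, ∃ x ∈ P j, ∃ y ∈ Q j, H.Adj x y) {S : Finset V} (hS : S.card < k) :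
    ∃ j < k, ∃ x ∈ P j, ∃ y ∈ Q j, x ∉ S ∧ y ∉ S ∧ H.Adj x y := by
  by_contra hcon
  push Not at hcon
  have hmeet : ∀ j, ∃ v, j < k → v ∈ S ∧ v ∈ P j ∪ Q j := by
    intro j
    by_cases hj : j < k
    · obtain ⟨x, hx, y, hy, hxy⟩ := hadj j hj
      by_cases hxS : x ∈ S
      · exact ⟨x, fun _ => ⟨hxS, mem_union_left _ hx⟩⟩
      · by_cases hyS : y ∈ S
        · exact ⟨y, fun _ => ⟨hyS, mem_union_right _ hy⟩⟩
        · exact absurd hxy (hcon j hj x hx y hy hxS hyS)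
    · obtain ⟨x, -⟩ := hadj 0 (by omega)
      exact ⟨x, fun h => absurd h hj⟩
  choose f hf using hmeet
  have h1 : (range k).card ≤ S.card := by
    refine card_le_card_of_injOn f (fun j hj => (hf j (mem_range.1 hj)).1) ?_
    intro i hi j hj hij
    rw [mem_coe, mem_range] at hi hj
    by_contra hne
    exact Finset.disjoint_left.1 (hdisj i hi j hj hne) (hf i hi).2 (hij ▸ (hf j hj).2)
  rw [card_range] at h1
  omega

lemma exists_disjoint_subsets (A : Finset V) (k m : ℕ) (h : k * m ≤ A.card) :
    ∃ P : ℕ → Finset V, (∀ j < k, P j ⊆ A ∧ (P j).card = m) ∧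
      ∀ i < k, ∀ j < k, i ≠ j → Disjoint (P i) (P j) := by
  induction k generalizing A with
  | zero => exact ⟨fun _ => ∅, by simp, by simp⟩
  | succ k ih =>
    rw [Nat.succ_mul] at h
    obtain ⟨B, hBA, hB⟩ := exists_subset_card_eq (s := A) (n := m) (by omega)
    obtain ⟨P, hP, hPd⟩ := ih (A \ B) (by rw [card_sdiff_of_subset hBA]; omega)
    have hdisj : ∀ j < k, Disjoint (P j) B := fun j hj =>
      (disjoint_sdiff_self_left).mono_left (hP j hj).1
    refine ⟨fun j => if j = k then B else P j, fun j hj => ?_, fun i hi j hj hij => ?_⟩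
    · by_cases hjk : j = k
      · simp [hjk, hBA, hB]
      · simp only [hjk, if_false]
        exact ⟨(hP j (by omega)).1.trans sdiff_subset, (hP j (by omega)).2⟩
    · by_cases hik : i = k <;> by_cases hjk : j = k
      · omega
      · simp only [hik, hjk, if_true, if_false]
        exact (hdisj j (by omega)).symm
      · simp only [hik, hjk, if_true, if_false]
        exact hdisj i (by omega)
      · simp only [hik, hjk, if_false]
        exact hPd i (by omega) j (by omega) hij

variable [Fintype V]

lemma isVertexConnected_of_forall_cut {H : SimpleGraph V} {k : ℕ} (hk : k < Fintype.card V)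
    (h : ∀ S X : Finset V, S.card < k → Disjoint X S → X.Nonempty → (Xᶜ \ S).Nonempty →
      ∃ x ∈ X, ∃ y ∈ Xᶜ \ S, H.Adj x y) : H.IsVertexConnected k := by
  classical
  refine ⟨hk, fun S hS => ?_⟩
  obtain ⟨v₀, hv₀⟩ : ∃ v, v ∉ S := by
    by_contra hcon
    push Not at hcon
    have : S = univ := eq_univ_iff_forall.2 hcon
    rw [this, card_univ] at hS
    omega
  let a : ((S : Set V)ᶜ : Set V) := ⟨v₀, by simpa using hv₀⟩
  rw [connected_iff_exists_forall_reachable]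
  refine ⟨a, fun w => ?_⟩
  by_contra hw
  let X : Finset V := univ.filter fun v =>
    ∃ hv : v ∈ (S : Set V)ᶜ, (H.induce (S : Set V)ᶜ).Reachable a ⟨v, hv⟩
  have hXS : Disjoint X S := by
    rw [Finset.disjoint_left]
    intro v hv hvS
    obtain ⟨hv, -⟩ := (mem_filter.1 hv).2
    exact hv hvS
  have hX : v₀ ∈ X := mem_filter.2 ⟨mem_univ _, a.2, Reachable.refl _⟩
  have hY : (w : V) ∈ Xᶜ \ S := by
    rw [mem_sdiff, mem_compl]
    refine ⟨fun hwX => ?_, fun hwS => w.2 hwS⟩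
    obtain ⟨_, h1⟩ := (mem_filter.1 hwX).2
    exact hw h1
  obtain ⟨x, hx, y, hy, hxy⟩ := h S X hS hXS ⟨v₀, hX⟩ ⟨w, hY⟩
  obtain ⟨hxS, hx⟩ := (mem_filter.1 hx).2
  rw [mem_sdiff, mem_compl] at hy
  have hyS : y ∈ (S : Set V)ᶜ := by simpa using hy.2
  refine hy.1 (mem_filter.2 ⟨mem_univ _, hyS, hx.trans (Adj.reachable ?_)⟩)
  exact hxy

end Connectivity

end SimpleGraph

/-! ### The lower tail of the number of random edges -/

namespace SimpleGraph

open Finset MeasureTheory ProbabilityTheory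

variable {V : Type*} [Fintype V] [DecidableEq V]

/-- A Chernoff bound: Markov's inequality for `2 ^ (-Z)`, where `Z` is the number of edges of the
random graph among the pairs in `Q`. -/
lemma binomialRandom_real_card_inter_lt_le (p : unitInterval) {Q : Finset (Sym2 V)}
    (hQ : ∀ e ∈ Q, ¬ e.IsDiag) (t : ℕ) :
    (binomialRandom V p).real {R | (Q ∩ R.edgeBoard).card < t} ≤
      2 ^ t * (1 - (p : ℝ) / 2) ^ Q.card := by
  classical
  set u : Finset (Sym2 V) := univ.filter fun e => ¬ e.IsDiag with hu
  have hucoe : (u : Set (Sym2 V)) = Sym2.diagSetᶜ := by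
    ext e
    simp [hu]
  have hQu : Q ⊆ u := fun e he => by simp [hu, hQ e he]
  have hp0 : 0 ≤ (p : ℝ) := p.2.1
  have hp1 : 0 ≤ 1 - (p : ℝ) := sub_nonneg.2 p.2.2
  set 𝓛 : Finset (Finset (Sym2 V)) := u.powerset.filter fun s => (Q ∩ s).card < t
  have h1 : (binomialRandom V p).real {R | (Q ∩ R.edgeBoard).card < t} ≤
      (setBernoulli (Sym2.diagSetᶜ : Set (Sym2 V)) p).real (⋃ s ∈ 𝓛, {(s : Set (Sym2 V))}) := by
    rw [measureReal_def, measureReal_def, binomialRandom_apply']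
    refine ENNReal.toReal_mono (measure_ne_top _ _) (measure_mono ?_)
    rintro _ ⟨R, hR, rfl⟩
    simp only [Set.mem_iUnion, Set.mem_singleton_iff]
    refine ⟨R.edgeBoard, mem_filter.2 ⟨mem_powerset.2 fun e he => ?_, hR⟩, ?_⟩
    · simp only [hu, mem_filter, mem_univ, true_and]
      exact R.not_isDiag_of_mem_edgeSet (mem_edgeBoard.1 he)
    · ext e
      simp [mem_edgeBoard]
  have h2 : ∀ s ∈ u.powerset, (setBernoulli (Sym2.diagSetᶜ : Set (Sym2 V)) p).real
      {(s : Set (Sym2 V))} = (p : ℝ) ^ s.card * (1 - p : ℝ) ^ (u \ s).card := by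
    intro s hs
    rw [← hucoe, setBernoulli_real_singleton p (coe_subset.2 (mem_powerset.1 hs)) (finite_toSet u),
      Set.ncard_coe_finset, ← coe_sdiff, Set.ncard_coe_finset]
  have h3 : ∑ s ∈ u.powerset, ((p : ℝ) ^ s.card * (1 - p : ℝ) ^ (u \ s).card) *
      (1 / 2) ^ (Q ∩ s).card = (1 - (p : ℝ) / 2) ^ Q.card := by
    have h4 := prod_add (fun e => (p : ℝ) * if e ∈ Q then 1 / 2 else 1) (fun _ => 1 - (p : ℝ)) u
    have h5 : ∏ e ∈ u, ((p : ℝ) * (if e ∈ Q then 1 / 2 else 1) + (1 - (p : ℝ))) =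
        (1 - (p : ℝ) / 2) ^ Q.card := by
      rw [← prod_subset hQu (fun e _ he => by simp [he]), prod_congr rfl
        (g := fun _ => 1 - (p : ℝ) / 2) (fun e he => by rw [if_pos he]; ring), prod_const]
    rw [← h5, h4]
    refine sum_congr rfl fun s _ => ?_
    rw [prod_mul_distrib, prod_const, prod_const, prod_ite, prod_const, prod_const_one, mul_one,
      filter_mem_eq_inter, inter_comm s Q]
    ring
  refine h1.trans ((measureReal_biUnion_finset_le _ _).trans ?_)
  rw [← h3, mul_sum]
  refine (sum_le_sum (fun s hs => ?_)).trans
    (sum_le_sum_of_subset_of_nonneg (filter_subset _ _) (fun s _ _ => by positivity))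
  obtain ⟨hs, hlt⟩ := mem_filter.1 hs
  rw [h2 s hs]
  have h6 : (1 : ℝ) ≤ 2 ^ t * (1 / 2) ^ (Q ∩ s).card := by
    rw [one_div, inv_pow, ← div_eq_mul_inv, one_le_div (by positivity)]
    exact pow_le_pow_right₀ (by norm_num) hlt.le
  calc (p : ℝ) ^ s.card * (1 - p : ℝ) ^ (u \ s).card
      ≤ ((p : ℝ) ^ s.card * (1 - p : ℝ) ^ (u \ s).card) * (2 ^ t * (1 / 2) ^ (Q ∩ s).card) :=
        le_mul_of_one_le_right (by positivity) h6
    _ = _ := by ring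

end SimpleGraph

/-! ### Maker's win from central cuts -/

namespace SimpleGraph

open Finset

lemma sum_nonempty_pow_card {V : Type*} [Fintype V] (ρ : ℝ) :
    ∑ D : Finset V, (if D.Nonempty then ρ ^ D.card else 0) = (1 + ρ) ^ Fintype.card V - 1 := by
  classical
  have h := Fintype.sum_pow_mul_eq_add_pow V ρ 1
  simp only [one_pow, mul_one] at h
  rw [add_comm, ← h, eq_sub_iff_add_eq, ← sum_erase_add _ _ (mem_univ (∅ : Finset V)),
    ← sum_erase_add (a := ∅) _ (fun D : Finset V => ρ ^ D.card) (mem_univ _)]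
  simp only [Finset.not_nonempty_empty, if_false, card_empty, pow_zero, add_zero]
  congr 1
  refine sum_congr rfl fun D hD => ?_
  rw [if_pos (nonempty_iff_ne_empty.2 (ne_of_mem_erase hD))]

/-- The number of sets with fewer than `k` elements is at most `e n ^ k`, because the weights
`n ^ (-|S|)` of all sets add up to `(1 + 1 / n) ^ n`. -/
lemma card_filter_card_lt_le {V : Type*} [Fintype V] [Nonempty V] (k : ℕ) :
    ((univ.filter fun S : Finset V => S.card < k).card : ℝ) ≤ 3 * (Fintype.card V : ℝ) ^ k := by
  set n : ℝ := (Fintype.card V : ℝ) with hn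
  have hn1 : 1 ≤ n := by rw [hn]; exact_mod_cast Fintype.card_pos
  have h := Fintype.sum_pow_mul_eq_add_pow V (1 / n) 1
  simp only [one_pow, mul_one] at h
  have h1 : (1 / n + 1) ^ Fintype.card V ≤ 3 := by
    calc (1 / n + 1) ^ Fintype.card V ≤ (Real.exp (1 / n)) ^ Fintype.card V := by
          gcongr
          exact Real.add_one_le_exp _
      _ = Real.exp 1 := by
          rw [← Real.exp_nat_mul, ← hn, mul_one_div_cancel (by positivity)]
      _ ≤ 3 := Real.exp_one_lt_three.le
  calc ((univ.filter fun S : Finset V => S.card < k).card : ℝ)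
      = ∑ S : Finset V with S.card < k, (1 : ℝ) := by simp
    _ ≤ ∑ S : Finset V with S.card < k, n ^ k * (1 / n) ^ S.card := by
        refine sum_le_sum fun S hS => ?_
        rw [one_div, inv_pow, ← div_eq_mul_inv, one_le_div (by positivity)]
        exact pow_le_pow_right₀ hn1 (mem_filter.1 hS).2.le
    _ ≤ ∑ S : Finset V, n ^ k * (1 / n) ^ S.card :=
        sum_le_sum_of_subset_of_nonneg (filter_subset _ _) (fun _ _ _ => by positivity)
    _ = n ^ k * (1 / n + 1) ^ Fintype.card V := by rw [← mul_sum, h]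
    _ ≤ 3 * n ^ k := by
        rw [mul_comm]
        gcongr

variable {V : Type*} [Fintype V] [DecidableEq V]

lemma sum_symmDiff_sdiff_le {ρ : ℝ} (hρ : 0 ≤ ρ) (C S : Finset V) :
    ∑ X : Finset V with Disjoint X S,
      (if (symmDiff X C \ S).Nonempty then ρ ^ (symmDiff X C \ S).card else 0) ≤
      (1 + ρ) ^ Fintype.card V - 1 := by
  rw [← sum_nonempty_pow_card]
  have hinj : Set.InjOn (fun X : Finset V => symmDiff X C \ S)
      (univ.filter fun X : Finset V => Disjoint X S : Finset (Finset V)) := by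
    intro X hX X' hX' heq
    have h1 := (mem_filter.1 hX).2
    have h2 := (mem_filter.1 hX').2
    ext v
    have h3 : v ∈ symmDiff X C \ S ↔ v ∈ symmDiff X' C \ S := by
      simp only at heq
      rw [heq]
    have h4 : v ∈ X → v ∉ S := fun h => Finset.disjoint_left.1 h1 h
    have h5 : v ∈ X' → v ∉ S := fun h => Finset.disjoint_left.1 h2 h
    simp only [mem_sdiff, mem_symmDiff] at h3
    tauto
  rw [← sum_image (f := fun D : Finset V => if D.Nonempty then ρ ^ D.card else 0) hinj]
  refine sum_le_sum_of_subset_of_nonneg (subset_univ _) fun D _ _ => ?_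
  split_ifs <;> positivity

/-- The deterministic part of the argument. The targets are, on the one hand, all edges between the
two sides of each partition outside of a set `S` with `|S| < k`, except for the partitions induced
by the sets in `𝒞'`; and on the other hand, for each `C ∈ 𝒞'`, the edges between `P C j` and `Q C j`
for all `j < k`. Hitting the latter yields `k` disjoint edges across the cut `C`, so that this cut is
still crossed after the deletion of fewer than `k` vertices. -/
lemma makerWinsVertexConnectivity_of_central_cuts [Nonempty V] {G H : SimpleGraph V}
    [DecidableRel G.Adj] (hGH : G ≤ H) {b k : ℕ} (hb : 1 ≤ b) (hk : k < Fintype.card V)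
    {𝒞 𝒞' : Finset (Finset V)} {β γ ρ : ℝ} (hρ : 0 ≤ ρ)
    (hcut : ∀ S X : Finset V, S.card < k → Disjoint X S → X.Nonempty → (Xᶜ \ S).Nonempty →
      β ≤ (G.interedges X (Xᶜ \ S)).card ∨
      ∃ C ∈ 𝒞, γ * ((symmDiff X C \ S).card : ℝ) ≤ (G.interedges X (Xᶜ \ S)).card ∧
        ((symmDiff X C \ S).Nonempty ∨ C ∈ 𝒞'))
    (hβ : (2 : ℝ) ^ (-β / b) ≤ ρ ^ Fintype.card V) (hγ : (2 : ℝ) ^ (-γ / b) ≤ ρ)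
    {P Q : Finset V → ℕ → Finset V}
    (hP : ∀ C ∈ 𝒞', ∀ j < k, P C j ⊆ C) (hQ : ∀ C ∈ 𝒞', ∀ j < k, Q C j ⊆ Cᶜ)
    (hPd : ∀ C ∈ 𝒞', ∀ i < k, ∀ j < k, i ≠ j → Disjoint (P C i) (P C j))
    (hQd : ∀ C ∈ 𝒞', ∀ i < k, ∀ j < k, i ≠ j → Disjoint (Q C i) (Q C j))
    {K : ℕ} (hPQ : ∀ C ∈ 𝒞', ∀ j < k, K * b ≤ (crossEdges (P C j) (Q C j) ∩ H.edgeBoard).card)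
    (hsum : 3 * (Fintype.card V : ℝ) ^ k * ((2 * ρ) ^ Fintype.card V +
      𝒞.card * ((1 + ρ) ^ Fintype.card V - 1)) + 𝒞'.card * k * (1 / 2) ^ K < 1 / 2) :
    H.MakerWinsVertexConnectivity b k := by
  classical
  intro first
  have hb' : (0 : ℝ) < b := by exact_mod_cast hb
  let I : Finset (Finset V × Finset V) := univ.filter fun z => z.1.card < k ∧ Disjoint z.2 z.1 ∧
    z.2.Nonempty ∧ (z.2ᶜ \ z.1).Nonempty ∧ ∀ C ∈ 𝒞', (symmDiff z.2 C \ z.1).Nonempty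
  let J : Finset (Finset V × ℕ) := 𝒞' ×ˢ range k
  let T : (Finset V × Finset V) ⊕ (Finset V × ℕ) → Finset (Sym2 V) :=
    Sum.elim (fun z => crossEdges z.2 (z.2ᶜ \ z.1) ∩ H.edgeBoard)
      (fun z => crossEdges (P z.1 z.2) (Q z.1 z.2) ∩ H.edgeBoard)
  have : Nonempty (Sym2 V) := ⟨s(Classical.arbitrary V, Classical.arbitrary V)⟩
  refine MakerBreaker.makerWins_of_sum_lt hb H.edgeBoard _ first (I.disjSum J) T ?_ ?_ ?_
  · rintro (z | z) - <;> exact inter_subset_right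
  · rw [sum_disjSum]
    refine lt_of_le_of_lt (add_le_add ?_ ?_) hsum
    · have hterm : ∀ z ∈ I, (2 : ℝ) ^ (-((T (Sum.inl z)).card : ℝ) / b) ≤ ρ ^ Fintype.card V +
          ∑ C ∈ 𝒞, (if (symmDiff z.2 C \ z.1).Nonempty then
            ρ ^ (symmDiff z.2 C \ z.1).card else 0) := by
        rintro ⟨S, X⟩ hz
        obtain ⟨hS, hXS, hX, hY, hC'⟩ := (mem_filter.1 hz).2
        simp only at hS hXS hX hY hC'
        have hT : ((G.interedges X (Xᶜ \ S)).card : ℝ) ≤ (T (Sum.inl (S, X))).card := by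
          exact_mod_cast card_interedges_le_card_crossEdges hGH
            (disjoint_compl_right.mono_right sdiff_subset)
        have hnn : ∀ C : Finset V, 0 ≤ (if (symmDiff X C \ S).Nonempty then
            ρ ^ (symmDiff X C \ S).card else 0) := fun C => by split_ifs <;> positivity
        rcases hcut S X hS hXS hX hY with h | ⟨C, hC, h, hD⟩
        · refine le_add_of_le_of_nonneg (le_trans ?_ hβ) (sum_nonneg fun C _ => hnn C)
          apply Real.rpow_le_rpow_of_exponent_le (by norm_num)
          gcongr
          exact h.trans hT
        · have hD : (symmDiff X C \ S).Nonempty := hD.elim id (hC' C)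
          refine le_add_of_nonneg_of_le (by positivity) ?_
          refine le_trans ?_ (single_le_sum (fun C _ => hnn C) hC)
          rw [if_pos hD]
          calc (2 : ℝ) ^ (-((T (Sum.inl (S, X))).card : ℝ) / b)
              ≤ (2 : ℝ) ^ (-γ / b * (symmDiff X C \ S).card) := by
                apply Real.rpow_le_rpow_of_exponent_le (by norm_num)
                rw [div_mul_eq_mul_div]
                gcongr
                linarith
            _ = ((2 : ℝ) ^ (-γ / b)) ^ (symmDiff X C \ S).card := by
                rw [Real.rpow_mul (by norm_num), Real.rpow_natCast]
            _ ≤ _ := by gcongr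
      refine (sum_le_sum hterm).trans ?_
      have hI : I ⊆ (univ.filter fun S : Finset V => S.card < k).biUnion fun S =>
          (univ.filter fun X : Finset V => Disjoint X S).image (Prod.mk S) := by
        rintro ⟨S, X⟩ hz
        obtain ⟨hS, hXS, -⟩ := (mem_filter.1 hz).2
        simp only [mem_biUnion, mem_image, mem_filter, mem_univ, true_and]
        exact ⟨S, hS, X, hXS, rfl⟩
      have hnn : ∀ z : Finset V × Finset V, 0 ≤ ρ ^ Fintype.card V +
          ∑ C ∈ 𝒞, (if (symmDiff z.2 C \ z.1).Nonempty then
            ρ ^ (symmDiff z.2 C \ z.1).card else 0) := fun z => by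
        refine add_nonneg (by positivity) (sum_nonneg fun C _ => ?_)
        split_ifs <;> positivity
      refine (sum_le_sum_of_subset_of_nonneg hI fun z _ _ => hnn z).trans ?_
      rw [sum_biUnion]
      · calc _ ≤ ∑ S : Finset V with S.card < k, ((2 * ρ) ^ Fintype.card V +
              𝒞.card * ((1 + ρ) ^ Fintype.card V - 1)) := by
              refine sum_le_sum fun S _ => ?_
              rw [sum_image (Prod.mk_right_injective S).injOn, sum_add_distrib, sum_comm]
              refine add_le_add ?_ ?_
              · rw [sum_const, nsmul_eq_mul, mul_pow]
                gcongr
                have := (card_filter_le (univ : Finset (Finset V)) fun X => Disjoint X S)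
                rw [card_univ, Fintype.card_finset] at this
                exact_mod_cast this
              · rw [← nsmul_eq_mul, ← sum_const]
                exact sum_le_sum fun C _ => sum_symmDiff_sdiff_le hρ C S
          _ ≤ _ := by
              rw [sum_const, nsmul_eq_mul]
              have h1 : (1 : ℝ) ≤ (1 + ρ) ^ Fintype.card V := one_le_pow₀ (by linarith)
              have h2 : 0 ≤ (2 * ρ) ^ Fintype.card V +
                  𝒞.card * ((1 + ρ) ^ Fintype.card V - 1) :=
                add_nonneg (by positivity) (mul_nonneg (by positivity) (by linarith))
              exact mul_le_mul_of_nonneg_right (card_filter_card_lt_le k) h2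
      · intro S _ S' _ hne
        rw [Function.onFun, Finset.disjoint_left]
        simp only [mem_image, not_exists, not_and]
        rintro _ ⟨w, -, rfl⟩ w' - h
        exact hne (Prod.mk.inj h).1.symm
    · have hJ : ∀ z ∈ J, (2 : ℝ) ^ (-((T (Sum.inr z)).card : ℝ) / b) ≤ (1 / 2) ^ K := by
        rintro ⟨C, j⟩ hz
        obtain ⟨hC, hj⟩ := mem_product.1 hz
        have h1 : ((K : ℝ) * b) ≤ (T (Sum.inr (C, j))).card := by
          exact_mod_cast hPQ C hC j (mem_range.1 hj)
        rw [one_div, inv_pow, ← Real.rpow_natCast, ← Real.rpow_neg (by norm_num)]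
        apply Real.rpow_le_rpow_of_exponent_le (by norm_num)
        rw [div_le_iff₀ hb']
        linarith
      refine (sum_le_sum hJ).trans (le_of_eq ?_)
      rw [sum_const, nsmul_eq_mul, card_product, card_range]
      push_cast
      ring
  · intro M hM hhit
    refine ⟨M, ⟨fun e he => mem_edgeBoard.1 (hM he), ?_⟩, Subset.rfl⟩
    have hadj : ∀ X Y : Finset V, Disjoint X Y →
        (∃ e ∈ crossEdges X Y ∩ H.edgeBoard, e ∈ M) →
        ∃ x ∈ X, ∃ y ∈ Y, (fromEdgeSet (M : Set (Sym2 V))).Adj x y := by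
      rintro X Y hXY ⟨e, he, heM⟩
      obtain ⟨x, hx, y, hy, rfl⟩ := mem_crossEdges.1 (mem_inter.1 he).1
      refine ⟨x, hx, y, hy, ?_⟩
      rw [fromEdgeSet_adj]
      refine ⟨heM, ?_⟩
      rintro rfl
      exact Finset.disjoint_left.1 hXY hx hy
    refine isVertexConnected_of_forall_cut hk fun S X hS hXS hX hY => ?_
    by_cases hC' : ∀ C ∈ 𝒞', (symmDiff X C \ S).Nonempty
    · refine hadj X (Xᶜ \ S) (disjoint_compl_right.mono_right sdiff_subset) ?_
      exact hhit (Sum.inl (S, X)) (inl_mem_disjSum.2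
        (mem_filter.2 ⟨mem_univ _, hS, hXS, hX, hY, hC'⟩))
    · push Not at hC'
      obtain ⟨C, hC, hD⟩ := hC'
      have hPQd : ∀ i < k, ∀ j < k, Disjoint (P C i) (Q C j) := fun i hi j hj =>
        disjoint_compl_right.mono (hP C hC i hi) (hQ C hC j hj)
      have hd : ∀ i < k, ∀ j < k, i ≠ j → Disjoint (P C i ∪ Q C i) (P C j ∪ Q C j) := by
        intro i hi j hj hij
        rw [disjoint_union_left, disjoint_union_right, disjoint_union_right]
        exact ⟨⟨hPd C hC i hi j hj hij, hPQd i hi j hj⟩, (hPQd j hj i hi).symm,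
          hQd C hC i hi j hj hij⟩
      have he : ∀ j < k, ∃ x ∈ P C j, ∃ y ∈ Q C j, (fromEdgeSet (M : Set (Sym2 V))).Adj x y := by
        intro j hj
        refine hadj _ _ (hPQd j hj j hj) ?_
        exact hhit (Sum.inr (C, j)) (inr_mem_disjSum.2 (mem_product.2 ⟨hC, mem_range.2 hj⟩))
      obtain ⟨j, hj, x, hx, y, hy, hxS, hyS, hxy⟩ := exists_adj_of_disjoint_pairs hd he hS
      have hv : ∀ v, v ∉ S → (v ∈ X ↔ v ∈ C) := by
        intro v hvS
        have : v ∉ symmDiff X C \ S := by simp [hD]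
        simp only [mem_sdiff, mem_symmDiff] at this
        tauto
      have hxC := hP C hC j hj hx
      have hyC := hQ C hC j hj hy
      refine ⟨x, (hv x hxS).2 hxC, y, ?_, hxy⟩
      rw [mem_compl] at hyC
      rw [mem_sdiff, mem_compl, hv y hyS]
      exact ⟨hyC, hyS⟩

end SimpleGraph

/-! ### Estimates and conclusion -/

lemma two_rpow_neg_div_le_inv_pow {n b m : ℕ} (hn : 1 ≤ n) (hb : 1 ≤ b) {x : ℝ}
    (h : (m : ℝ) * (b * Real.log n) ≤ x * Real.log 2) :
    (2 : ℝ) ^ (-x / b) ≤ ((n : ℝ) ^ m)⁻¹ := by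
  have hb' : (0 : ℝ) < b := by exact_mod_cast hb
  have hn' : (0 : ℝ) < n := by exact_mod_cast hn
  rw [← Real.exp_log (pow_pos hn' m), ← Real.exp_neg, Real.rpow_def_of_pos (by norm_num),
    Real.exp_le_exp, Real.log_pow, neg_div, mul_neg, neg_le_neg_iff, mul_div_assoc',
    le_div_iff₀ hb']
  linarith

lemma one_add_pow_sub_one_le {ρ : ℝ} {n : ℕ} (hρ : 0 ≤ ρ) (h : n * ρ ≤ 1) :
    (1 + ρ) ^ n - 1 ≤ 2 * (n * ρ) := by
  have h0 : 0 ≤ n * ρ := by positivity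
  have h1 : (1 + ρ) ^ n ≤ Real.exp (n * ρ) := by
    rw [Real.exp_nat_mul]
    gcongr
    linarith [Real.add_one_le_exp ρ]
  have h2 := (abs_le.1 (Real.abs_exp_sub_one_sub_id_le (x := n * ρ) (by rwa [abs_of_nonneg h0]))).2
  nlinarith

/-- With `ρ = n ^ (-(k + 2))`, the total danger of the partitions that are not induced by a central
cut is of order `L / n`. -/
lemma danger_of_partitions_le {n k : ℕ} {L : ℝ} (hL : 0 ≤ L) (hn : 48 + 48 * L ≤ n) :
    3 * (n : ℝ) ^ k * ((2 * ((n : ℝ) ^ (k + 2))⁻¹) ^ n +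
      L * ((1 + ((n : ℝ) ^ (k + 2))⁻¹) ^ n - 1)) ≤ 1 / 8 := by
  have hn2 : (2 : ℝ) ≤ n := by linarith
  have hn0 : (0 : ℝ) < n := by linarith
  have hnne : n ≠ 0 := by
    rintro rfl
    simp at hn0
  set ρ : ℝ := ((n : ℝ) ^ (k + 2))⁻¹ with hρdef
  have hρ : 0 ≤ ρ := by positivity
  have hρ1 : (n : ℝ) ^ (k + 1) * (n * ρ) = 1 := by
    rw [hρdef, ← mul_assoc, ← pow_succ]
    exact mul_inv_cancel₀ (by positivity)
  have hnk : (1 : ℝ) ≤ (n : ℝ) ^ (k + 1) := one_le_pow₀ (by linarith)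
  have hnρ : n * ρ ≤ 1 := by
    rw [← hρ1]
    exact le_mul_of_one_le_left (by positivity) hnk
  have h2ρ : 2 * ρ ≤ n * ρ := by gcongr
  have h1 : (2 * ρ) ^ n ≤ 2 * (n * ρ) := by
    calc (2 * ρ) ^ n ≤ 2 * ρ := pow_le_of_le_one (by positivity) (by linarith) hnne
      _ ≤ 2 * (n * ρ) := by linarith [mul_nonneg hn0.le hρ]
  have h2 := one_add_pow_sub_one_le hρ hnρ
  calc 3 * (n : ℝ) ^ k * ((2 * ρ) ^ n + L * ((1 + ρ) ^ n - 1))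
      ≤ 3 * (n : ℝ) ^ k * (2 * (n * ρ) + L * (2 * (n * ρ))) := by gcongr
    _ = (6 + 6 * L) * ((n : ℝ) ^ (k + 1) * (n * ρ)) / n := by
        field_simp
        ring
    _ ≤ 1 / 8 := by
        rw [hρ1, mul_one, div_le_iff₀ hn0]
        linarith

namespace SimpleGraph

open Finset MeasureTheory

/-- The union bound over `z ∈ J` for the event that fewer than `t` edges of the random graph run
between the disjoint `m`-sets `P z` and `Q z`. -/
lemma binomialRandom_real_exists_card_inter_lt_le {V ι : Type*} [Fintype V] [DecidableEq V]
    (p : unitInterval) (J : Finset ι) {P Q : ι → Finset V} {m t : ℕ}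
    (hd : ∀ z ∈ J, Disjoint (P z) (Q z)) (hP : ∀ z ∈ J, (P z).card = m)
    (hQ : ∀ z ∈ J, (Q z).card = m) :
    (binomialRandom V p).real
      {R | ∃ z ∈ J, (crossEdges (P z) (Q z) ∩ R.edgeBoard).card < t} ≤
      Real.exp (J.card + t - p * (m : ℝ) ^ 2 / 2) := by
  have hp0 : 0 ≤ (p : ℝ) := p.2.1
  have hp1 : (p : ℝ) ≤ 1 := p.2.2
  have hset : {R : SimpleGraph V | ∃ z ∈ J, (crossEdges (P z) (Q z) ∩ R.edgeBoard).card < t} =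
      ⋃ z ∈ J, {R : SimpleGraph V | (crossEdges (P z) (Q z) ∩ R.edgeBoard).card < t} := by
    ext R
    simp
  rw [hset]
  have hone : ∀ z ∈ J, (binomialRandom V p).real
      {R : SimpleGraph V | (crossEdges (P z) (Q z) ∩ R.edgeBoard).card < t} ≤
      Real.exp (t - p * (m : ℝ) ^ 2 / 2) := by
    intro z hz
    refine (binomialRandom_real_card_inter_lt_le p
      (fun e he => not_isDiag_of_mem_crossEdges (hd z hz) he) t).trans ?_
    rw [card_crossEdges (hd z hz), hP z hz, hQ z hz, sub_eq_add_neg (t : ℝ), Real.exp_add]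
    have h1 : (2 : ℝ) ^ t ≤ Real.exp t := by
      rw [← mul_one (t : ℝ), Real.exp_nat_mul]
      gcongr
      linarith [Real.add_one_le_exp (1 : ℝ)]
    have h2 : (1 - (p : ℝ) / 2) ^ (m * m) ≤ Real.exp (-(p * (m : ℝ) ^ 2 / 2)) := by
      have h3 : -((p : ℝ) * (m : ℝ) ^ 2 / 2) = ((m * m : ℕ) : ℝ) * (-(p / 2 : ℝ)) := by
        push_cast
        ring
      rw [h3, Real.exp_nat_mul]
      have h4 : (0 : ℝ) ≤ 1 - p / 2 := by linarith
      gcongr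
      linarith [Real.add_one_le_exp (-(p / 2 : ℝ))]
    have h4 : (0 : ℝ) ≤ 1 - p / 2 := by linarith
    gcongr
  refine (measureReal_biUnion_finset_le _ _).trans ((sum_le_sum hone).trans ?_)
  rw [sum_const, nsmul_eq_mul, add_sub_assoc, Real.exp_add]
  gcongr
  linarith [Real.add_one_le_exp (J.card : ℝ)]

/-- The probability bound for a fixed number of vertices, with all requirements on the parameters
spelled out. Here `r`, `δ` and `𝒞` are as in `exists_central_cuts`, and `K` is chosen such that the
danger of the targets across the central cuts is small. -/
lemma one_sub_exp_le_binomialRandom_real {n k r b K : ℕ} {α δ c : ℝ} (hα : 0 < α) (hk : 1 ≤ k)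
    (hr : 2 / α ≤ r) (hδ : 12 * ((2 ^ r + 1) * δ) ≤ α ^ 2)
    (hK : ((2 : ℝ) ^ r + 2) * k * (1 / 2) ^ K ≤ 1 / 8)
    (hcα : (k + 2) * c ≤ α / 8 * Real.log 2) (hcδ : (k + 2) * c ≤ δ / 4 * Real.log 2)
    (hcp : 64 * k ^ 2 * c ≤ α ^ 2)
    (hkn : k < n) (hkα : 8 * (k : ℝ) ≤ α * n) (hkδ : 4 * (k : ℝ) ≤ δ * n)
    (hn : 48 + 48 * ((2 : ℝ) ^ r + 2) ≤ n) (G : SimpleGraph (Fin n)) [DecidableRel G.Adj]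
    (hdeg : α * n ≤ G.minDegree) (hb : 1 ≤ b) (hbn : (b : ℝ) * Real.log n ≤ c * n)
    (p : unitInterval)
    (hp : 64 * (k : ℝ) ^ 2 * ((2 ^ r + 2) * k + K) * b ≤ α ^ 2 * (p * (n : ℝ) ^ 2)) :
    1 - Real.exp (-(c * (p : ℝ) * (n : ℝ) ^ 2)) ≤ (binomialRandom (Fin n) p).real
      {R : SimpleGraph (Fin n) | (G ⊔ R).MakerWinsVertexConnectivity b k} := by
  classical
  have hn1 : 1 ≤ n := by omega
  have : Nonempty (Fin n) := ⟨⟨0, by omega⟩⟩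
  have hn0 : (0 : ℝ) < n := by exact_mod_cast hn1
  have hk0 : (0 : ℝ) < k := by exact_mod_cast hk
  have hp0 : 0 ≤ (p : ℝ) := p.2.1
  have hdeg' : ∀ v, α * Fintype.card (Fin n) ≤ G.degree v := fun v => by
    rw [Fintype.card_fin]
    exact hdeg.trans (by exact_mod_cast G.minDegree_le_degree v)
  obtain ⟨𝒞, h𝒞, hcut⟩ := exists_central_cuts (k := k) hα hr hδ hdeg'
    (by rwa [Fintype.card_fin]) (by rwa [Fintype.card_fin])
  simp only [Fintype.card_fin] at hcut
  set 𝒞' := 𝒞.filter fun C => α / 2 * n ≤ C.card ∧ α / 2 * n ≤ Cᶜ.card with h𝒞'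
  set m := ⌊α * n / (2 * k)⌋₊ with hm
  have hkm : (k * m : ℕ) ≤ α / 2 * n := by
    have h1 : (m : ℝ) ≤ α * n / (2 * k) := Nat.floor_le (by positivity)
    push_cast
    calc (k : ℝ) * m ≤ k * (α * n / (2 * k)) := by gcongr
      _ = α / 2 * n := by field_simp
  have hm_ge : α * n / (4 * k) ≤ m := by
    have h1 : α * n / (2 * k) < m + 1 := Nat.lt_floor_add_one _
    have h2 : 1 ≤ α * n / (4 * k) := by
      rw [le_div_iff₀ (by positivity)]
      linarith
    have h3 : α * n / (2 * k) = α * n / (4 * k) + α * n / (4 * k) := by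
      field_simp
      norm_num
    linarith
  have hsets : ∀ C : Finset (Fin n), ∃ P Q : ℕ → Finset (Fin n), C ∈ 𝒞' →
      ((∀ j < k, P j ⊆ C ∧ (P j).card = m) ∧ ∀ i < k, ∀ j < k, i ≠ j → Disjoint (P i) (P j)) ∧
      ((∀ j < k, Q j ⊆ Cᶜ ∧ (Q j).card = m) ∧
        ∀ i < k, ∀ j < k, i ≠ j → Disjoint (Q i) (Q j)) := by
    intro C
    by_cases hC : C ∈ 𝒞'
    · obtain ⟨-, h1, h2⟩ := mem_filter.1 hC
      obtain ⟨P, hP⟩ := exists_disjoint_subsets C k m (by exact_mod_cast hkm.trans h1)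
      obtain ⟨Q, hQ⟩ := exists_disjoint_subsets Cᶜ k m (by exact_mod_cast hkm.trans h2)
      exact ⟨P, Q, fun _ => ⟨hP, hQ⟩⟩
    · exact ⟨fun _ => ∅, fun _ => ∅, fun h => absurd h hC⟩
  choose P Q hPQ using hsets
  set J := 𝒞' ×ˢ range k with hJ
  have hbad := binomialRandom_real_exists_card_inter_lt_le p J (P := fun z => P z.1 z.2)
    (Q := fun z => Q z.1 z.2) (m := m) (t := K * b)
    (fun z hz => by
      obtain ⟨h1, h2⟩ := mem_product.1 hz
      exact disjoint_compl_right.mono ((hPQ z.1 h1).1.1 z.2 (mem_range.1 h2)).1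
        ((hPQ z.1 h1).2.1 z.2 (mem_range.1 h2)).1)
    (fun z hz => ((hPQ z.1 (mem_product.1 hz).1).1.1 z.2 (mem_range.1 (mem_product.1 hz).2)).2)
    (fun z hz => ((hPQ z.1 (mem_product.1 hz).1).2.1 z.2 (mem_range.1 (mem_product.1 hz).2)).2)
  set bad := {R : SimpleGraph (Fin n) | ∃ z ∈ J,
    (crossEdges (P z.1 z.2) (Q z.1 z.2) ∩ R.edgeBoard).card < K * b}
  set good := {R : SimpleGraph (Fin n) | (G ⊔ R).MakerWinsVertexConnectivity b k}
  have h𝒞r : (𝒞.card : ℝ) ≤ 2 ^ r + 2 := by exact_mod_cast h𝒞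
  have h𝒞'r : (𝒞'.card : ℝ) ≤ 2 ^ r + 2 :=
    (Nat.cast_le.2 (card_filter_le _ _)).trans h𝒞r
  have hunion : (Set.univ : Set (SimpleGraph (Fin n))) ⊆ good ∪ bad := by
    intro R _
    by_cases hR : R ∈ bad
    · exact Or.inr hR
    left
    simp only [bad, Set.mem_ofPred_eq, not_exists, not_and, not_lt] at hR
    refine makerWinsVertexConnectivity_of_central_cuts (G := G) le_sup_left hb
      (by rwa [Fintype.card_fin]) (𝒞 := 𝒞) (𝒞' := 𝒞') (β := δ / 4 * (n : ℝ) ^ 2)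
      (γ := α / 8 * n) (ρ := ((n : ℝ) ^ (k + 2))⁻¹) (by positivity) ?_ ?_ ?_
      (fun C hC j hj => ((hPQ C hC).1.1 j hj).1) (fun C hC j hj => ((hPQ C hC).2.1 j hj).1)
      (fun C hC => (hPQ C hC).1.2) (fun C hC => (hPQ C hC).2.2) (K := K) ?_ ?_
    · intro S X hS hXS hX hY
      rcases hcut S X hS hXS hX hY with h | ⟨C, hC, h1, h2⟩
      · exact Or.inl h
      · exact Or.inr ⟨C, hC, h1, h2.imp_right fun h => mem_filter.2 ⟨hC, h⟩⟩
    · rw [Fintype.card_fin, inv_pow, ← pow_mul]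
      refine two_rpow_neg_div_le_inv_pow hn1 hb ?_
      push_cast
      calc ((k : ℝ) + 2) * n * (b * Real.log n) ≤ (k + 2) * n * (c * n) := by gcongr
        _ = (k + 2) * c * (n : ℝ) ^ 2 := by ring
        _ ≤ δ / 4 * Real.log 2 * (n : ℝ) ^ 2 := by gcongr
        _ = _ := by ring
    · refine two_rpow_neg_div_le_inv_pow hn1 hb ?_
      push_cast
      calc ((k : ℝ) + 2) * (b * Real.log n) ≤ (k + 2) * (c * n) := by gcongr
        _ = (k + 2) * c * n := by ring
        _ ≤ α / 8 * Real.log 2 * n := by gcongr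
        _ = _ := by ring
    · intro C hC j hj
      refine (hR (C, j) (mem_product.2 ⟨hC, mem_range.2 hj⟩)).trans (card_le_card ?_)
      refine inter_subset_inter_left fun e he => ?_
      rw [mem_edgeBoard] at he ⊢
      exact edgeSet_mono le_sup_right he
    · rw [Fintype.card_fin]
      have h1 := danger_of_partitions_le (k := k) (by positivity : (0 : ℝ) ≤ 2 ^ r + 2) hn
      have h2 : 3 * (n : ℝ) ^ k * ((2 * ((n : ℝ) ^ (k + 2))⁻¹) ^ n +
          𝒞.card * ((1 + ((n : ℝ) ^ (k + 2))⁻¹) ^ n - 1)) ≤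
          3 * (n : ℝ) ^ k * ((2 * ((n : ℝ) ^ (k + 2))⁻¹) ^ n +
          (2 ^ r + 2) * ((1 + ((n : ℝ) ^ (k + 2))⁻¹) ^ n - 1)) := by
        have h3 : (1 : ℝ) ≤ (1 + ((n : ℝ) ^ (k + 2))⁻¹) ^ n :=
          one_le_pow₀ (le_add_of_nonneg_right (by positivity))
        have h4 := sub_nonneg.2 h3
        gcongr
      have h3 : (𝒞'.card : ℝ) * k * (1 / 2) ^ K ≤ (2 ^ r + 2) * k * (1 / 2) ^ K := by gcongr
      linarith
  have hexp : (J.card : ℝ) + (K * b : ℕ) - p * (m : ℝ) ^ 2 / 2 ≤ -(c * (p : ℝ) * (n : ℝ) ^ 2) := by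
    have hJr : (J.card : ℝ) ≤ (2 ^ r + 2) * k := by
      rw [hJ, card_product, card_range]
      push_cast
      gcongr
    have hb1 : (1 : ℝ) ≤ b := by exact_mod_cast hb
    have hJb : (2 ^ r + 2 : ℝ) * k ≤ (2 ^ r + 2) * k * b :=
      le_mul_of_one_le_right (by positivity) hb1
    set x : ℝ := p * (n : ℝ) ^ 2 with hx
    have hx0 : 0 ≤ x := by positivity
    have h1 : (2 : ℝ) * ((α ^ 2 / (64 * k ^ 2)) * x) ≤ p * (m : ℝ) ^ 2 / 2 := by
      calc (2 : ℝ) * ((α ^ 2 / (64 * k ^ 2)) * x) = p * (α * n / (4 * k)) ^ 2 / 2 := by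
            rw [hx]
            field_simp
            ring
        _ ≤ _ := by gcongr
    have h2 : c * x ≤ (α ^ 2 / (64 * k ^ 2)) * x := by
      gcongr
      rw [le_div_iff₀ (by positivity)]
      linarith
    have h3 : ((2 ^ r + 2) * k + K : ℝ) * b ≤ (α ^ 2 / (64 * k ^ 2)) * x := by
      rw [div_mul_eq_mul_div, le_div_iff₀ (by positivity)]
      linarith
    push_cast
    linarith
  have hbad' := hbad.trans (Real.exp_le_exp.2 hexp)
  have h1 : (1 : ℝ) ≤
      (binomialRandom (Fin n) p).real good + (binomialRandom (Fin n) p).real bad := by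
    rw [← probReal_univ (μ := binomialRandom (Fin n) p)]
    exact (measureReal_mono hunion).trans (measureReal_union_le _ _)
  linarith

end SimpleGraph

theorem theorem1p3 (α : ℝ) (hα : 0 < α) (k : ℕ) (hk : 1 ≤ k) :
    ∃ C c : ℝ, 0 < C ∧ 0 < c ∧
      ∀ᶠ n : ℕ in Filter.atTop,
        ∀ (Gα : SimpleGraph (Fin n)) [DecidableRel Gα.Adj], α * (n : ℝ) ≤ (Gα.minDegree : ℝ) →
        ∀ b : ℕ, 1 ≤ b → (b : ℝ) ≤ c * (n : ℝ) / Real.log (n : ℝ) →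
        ∀ p : unitInterval, C * (b : ℝ) / (n : ℝ) ^ 2 ≤ (p : ℝ) →
          1 - Real.exp (-(c * (p : ℝ) * (n : ℝ) ^ 2)) ≤
            (SimpleGraph.binomialRandom (Fin n) p).real
              {R : SimpleGraph (Fin n) | (Gα ⊔ R).MakerWinsVertexConnectivity b k} := by
  have hk0 : (0 : ℝ) < k := by exact_mod_cast hk
  have hlog2 : 0 < Real.log 2 := Real.log_pos (by norm_num)
  obtain ⟨r, hr⟩ := exists_nat_ge (2 / α)
  set L : ℝ := 2 ^ r + 2 with hL
  have hL0 : 0 < L := by positivity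
  set δ : ℝ := α ^ 2 / (12 * (2 ^ r + 1)) with hδdef
  have hδ0 : 0 < δ := by positivity
  have hδ : 12 * ((2 ^ r + 1) * δ) ≤ α ^ 2 := by
    rw [hδdef]
    field_simp
    exact le_rfl
  obtain ⟨K, hK⟩ := exists_pow_lt_of_lt_one (show (0 : ℝ) < 1 / 8 / (L * k) by positivity)
    (show (1 / 2 : ℝ) < 1 by norm_num)
  have hK' : L * k * (1 / 2) ^ K ≤ 1 / 8 := by
    rw [lt_div_iff₀ (by positivity)] at hK
    linarith
  set c : ℝ := min (α ^ 2 / (64 * k ^ 2))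
    (min (α / 8 * Real.log 2 / (k + 2)) (δ / 4 * Real.log 2 / (k + 2))) with hc
  have hc0 : 0 < c := by
    rw [hc]
    refine lt_min ?_ (lt_min ?_ ?_) <;> positivity
  have hcp : 64 * k ^ 2 * c ≤ α ^ 2 := by
    have : c ≤ α ^ 2 / (64 * k ^ 2) := min_le_left _ _
    rw [le_div_iff₀ (by positivity)] at this
    linarith
  have hcα : (k + 2) * c ≤ α / 8 * Real.log 2 := by
    have : c ≤ α / 8 * Real.log 2 / (k + 2) := (min_le_right _ _).trans (min_le_left _ _)
    rw [le_div_iff₀ (by positivity)] at this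
    linarith
  have hcδ : (k + 2) * c ≤ δ / 4 * Real.log 2 := by
    have : c ≤ δ / 4 * Real.log 2 / (k + 2) := (min_le_right _ _).trans (min_le_right _ _)
    rw [le_div_iff₀ (by positivity)] at this
    linarith
  refine ⟨64 * k ^ 2 * (L * k + K) / α ^ 2, c, by positivity, hc0, ?_⟩
  filter_upwards [Filter.eventually_gt_atTop k,
    Filter.eventually_ge_atTop ⌈8 * (k : ℝ) / α⌉₊, Filter.eventually_ge_atTop ⌈4 * (k : ℝ) / δ⌉₊,
    Filter.eventually_ge_atTop ⌈48 + 48 * L⌉₊] with n hkn h8 h4 h48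
  intro G _ hdeg b hb hbn p hp
  have h48' : 48 + 48 * L ≤ n := Nat.ceil_le.1 h48
  have hn0 : (0 : ℝ) < n := by linarith
  refine SimpleGraph.one_sub_exp_le_binomialRandom_real hα hk hr hδ hK' hcα hcδ hcp hkn ?_ ?_
    h48' G hdeg hb ?_ p ?_
  · have := Nat.ceil_le.1 h8
    rw [div_le_iff₀ hα] at this
    linarith
  · have := Nat.ceil_le.1 h4
    rw [div_le_iff₀ hδ0] at this
    linarith
  · exact (le_div_iff₀ (Real.log_pos (by linarith))).1 hbn
  · rw [div_le_iff₀ (by positivity), div_mul_eq_mul_div, div_le_iff₀ (by positivity)] at hp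
    linarith
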